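/- Let $r\in[1,\infty]$, with $1/\infty=0$. For $G:\mathbb R\to\mathbb C$ and $r<\infty$ let $$V_r(G)=\sup_{J\ge 0}\ \sup_{t_0<\dots<t_J}\Big(\sum_{j=0}^{J-1}|G(t_{j+1})-G(t_j)|^r\Big)^{1/r}\in[0,\infty],$$ where the $t_j$ are real, and let $V_\infty(G)=\sup_{s,t\in\mathbb R}|G(t)-G(s)|$. For $\alpha\in[0,1]$ and a compactly supported $F\in L^r(\mathbb R)$ let $D^\alpha F$ be the tempered distribution on $\mathbb R$ whose Fourier transform is the function $(2\pi|\xi|)^\alpha\widehat F(\xi)$, where $\widehat F(\xi)=\int_{\mathbb R}F(x)e^{-2\pi i\xi x}\,dx$. (i) For every $\alpha\in[0,1]$ with $\alpha>1/r$ there is a constant $C_{\alpha,r}>0$ such that for every compactly supported $F:\mathbb R\to\mathbb C$ with $F\in L^r(\mathbb R)$ and $D^\alpha F\in L^r(\mathbb R)$ the following holds: $F$ agrees almost everywhere with a continuous function $\widetilde F$, and $$V_r(\widetilde F)\le C_{\alpha,r}\big(\|F\|_{L^r(\mathbb R)}+\|D^\alpha F\|_{L^r(\mathbb R)}\big).$$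 (ii) Conversely, for every $\beta\in[0,1]$ with $\beta<1/r$ there is a constant $C_{\beta,r}>0$ such that for every compactly supported $F:\mathbb R\to\mathbb C$ with $F\in L^r(\mathbb R)$ and $V_r(F)<\infty$ the distribution $D^\beta F$ belongs to $L^r(\mathbb R)$ and $$\|D^\beta F\|_{L^r(\mathbb R)}\le C_{\beta,r}\big(\|F\|_{L^r(\mathbb R)}+V_r(F)\big).$$ -/

import Mathlib

open MeasureTheory SchwartzMap FourierTransform
open scoped NNReal ENNReal

/-- `u` is measurable and of at most polynomial growth. -/
def PolyGrowth (u : ℝ → ℂ) : Prop :=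
  AEStronglyMeasurable u volume ∧ ∃ (n : ℕ) (C : ℝ), 0 ≤ C ∧ ∀ x, ‖u x‖ ≤ C * (1 + ‖x‖) ^ n

theorem PolyGrowth.bound {u : ℝ → ℂ} (hu : PolyGrowth u) :
    ∃ (s : Finset (ℕ × ℕ)) (C : ℝ), 0 ≤ C ∧ ∀ φ : 𝓢(ℝ, ℂ), ∀ x,
      ‖φ x • u x‖ ≤ C * s.sup (schwartzSeminormFamily ℂ ℝ ℂ) φ * (1 + ‖x‖) ^ (-2 : ℝ) := by
  obtain ⟨-, n, C, hC, h⟩ := hu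
  refine ⟨Finset.Iic (n + 2, 0), C * 2 ^ (n + 2), by positivity, fun φ x => ?_⟩
  have h1 := one_add_le_sup_seminorm_apply (𝕜 := ℂ) (m := (n + 2, 0)) (k := n + 2) (n := 0)
    le_rfl le_rfl φ x
  rw [norm_iteratedFDeriv_zero] at h1
  have hx : (0 : ℝ) < 1 + ‖x‖ := by positivity
  have h2 : (1 + ‖x‖) ^ (-2 : ℝ) = ((1 + ‖x‖) ^ 2)⁻¹ := by
    rw [Real.rpow_neg hx.le]; norm_num
  rw [h2, ← div_eq_mul_inv, le_div_iff₀ (by positivity), norm_smul]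
  calc ‖φ x‖ * ‖u x‖ * (1 + ‖x‖) ^ 2
      ≤ ‖φ x‖ * (C * (1 + ‖x‖) ^ n) * (1 + ‖x‖) ^ 2 := by gcongr; exact h x
    _ = C * ((1 + ‖x‖) ^ (n + 2) * ‖φ x‖) := by ring
    _ ≤ C * (2 ^ (n + 2) * (Finset.Iic (n + 2, 0)).sup
          (fun m => SchwartzMap.seminorm ℂ m.1 m.2) φ) := by gcongr
    _ = C * 2 ^ (n + 2) * (Finset.Iic (n + 2, 0)).sup (schwartzSeminormFamily ℂ ℝ ℂ) φ := by
        rw [mul_assoc]; rfl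

theorem integrable_one_add_norm_neg_two :
    Integrable (fun x : ℝ => (1 + ‖x‖) ^ (-2 : ℝ)) volume :=
  integrable_one_add_norm (by simp)

theorem PolyGrowth.integrable {u : ℝ → ℂ} (hu : PolyGrowth u) (φ : 𝓢(ℝ, ℂ)) :
    Integrable (fun x => φ x • u x) volume := by
  obtain ⟨s, C, -, h⟩ := hu.bound
  exact Integrable.mono' (integrable_one_add_norm_neg_two.const_mul _)
    (φ.continuous.aestronglyMeasurable.smul hu.1) (Filter.Eventually.of_forall (h φ))

/-- The tempered distribution `φ ↦ ∫ φ u` given by a measurable function `u` of at most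
polynomial growth. -/
noncomputable def PolyGrowth.toDistribution {u : ℝ → ℂ} (hu : PolyGrowth u) : 𝓢'(ℝ, ℂ) :=
  ContinuousLinearMap.toPointwiseConvergenceCLM _ _ _ _ <|
    mkCLMtoNormedSpace (𝕜 := ℂ) (σ := RingHom.id ℂ) (fun φ : 𝓢(ℝ, ℂ) => ∫ x, φ x • u x)
      (fun f g => by
        simp only [SchwartzMap.add_apply, add_smul]
        exact integral_add (hu.integrable f) (hu.integrable g))
      (fun c f => by
        simp only [SchwartzMap.smul_apply, smul_assoc]
        exact integral_smul c _)
      (by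
        obtain ⟨s, C, hC, h⟩ := hu.bound
        refine ⟨s, C * ∫ x : ℝ, (1 + ‖x‖) ^ (-2 : ℝ),
          mul_nonneg hC (integral_nonneg fun x => by positivity), fun φ => ?_⟩
        calc ‖∫ x, φ x • u x‖
            ≤ ∫ x : ℝ, C * s.sup (schwartzSeminormFamily ℂ ℝ ℂ) φ * (1 + ‖x‖) ^ (-2 : ℝ) :=
              norm_integral_le_of_norm_le (integrable_one_add_norm_neg_two.const_mul _)
                (Filter.Eventually.of_forall (h φ))
          _ = _ := by rw [integral_const_mul]; ring)

theorem PolyGrowth.toDistribution_apply {u : ℝ → ℂ} (hu : PolyGrowth u) (φ : 𝓢(ℝ, ℂ)) :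
    hu.toDistribution φ = ∫ x, φ x • u x := rfl

/-- The function `ξ ↦ (2π|ξ|)^α 𝓕F(ξ)`, where `𝓕F(ξ) = ∫ F(x) e^{-2πiξx} dx`. -/
noncomputable def fracSymbol (α : ℝ≥0) (F : ℝ → ℂ) (ξ : ℝ) : ℂ :=
  (((2 * Real.pi * |ξ|) ^ (α : ℝ) : ℝ) : ℂ) * 𝓕 F ξ

/-- No hypothesis on `F` is needed here, since the Fourier integral of a non-integrable function
is `0` in Mathlib; for integrable `F` it is bounded and continuous. -/
theorem polyGrowth_fracSymbol (α : ℝ≥0) (F : ℝ → ℂ) : PolyGrowth (fracSymbol α F) := by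
  have hmeas : AEStronglyMeasurable (𝓕 F) volume := by
    by_cases hF : Integrable F
    · exact (VectorFourier.fourierIntegral_continuous Real.continuous_fourierChar
        (by fun_prop) hF).aestronglyMeasurable
    · have : 𝓕 F = fun _ => 0 := by
        funext ξ
        rw [Real.fourier_eq]
        refine integral_undef fun h => hF ?_
        rwa [Real.fourierIntegral_convergent_iff] at h
      rw [this]
      exact aestronglyMeasurable_const
  refine ⟨AEStronglyMeasurable.mul ?_ hmeas, ⌈(α : ℝ)⌉₊,
    (2 * Real.pi) ^ (α : ℝ) * ∫ x, ‖F x‖, ?_, fun ξ => ?_⟩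
  · exact (by fun_prop : Measurable fun ξ : ℝ =>
      (((2 * Real.pi * |ξ|) ^ (α : ℝ) : ℝ) : ℂ)).aestronglyMeasurable
  · exact mul_nonneg (by positivity) (integral_nonneg fun _ => norm_nonneg _)
  · have h1 : ‖𝓕 F ξ‖ ≤ ∫ x, ‖F x‖ :=
      VectorFourier.norm_fourierIntegral_le_integral_norm _ _ _ _ _
    have h2 : |ξ| ^ (α : ℝ) ≤ (1 + ‖ξ‖) ^ ⌈(α : ℝ)⌉₊ := by
      rw [← Real.rpow_natCast]
      calc |ξ| ^ (α : ℝ) ≤ (1 + ‖ξ‖) ^ (α : ℝ) := by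
            gcongr
            rw [Real.norm_eq_abs]; linarith
        _ ≤ _ := Real.rpow_le_rpow_of_exponent_le (by simp) (Nat.le_ceil _)
    rw [fracSymbol, norm_mul, Complex.norm_real, Real.norm_of_nonneg (by positivity),
      Real.mul_rpow (by positivity) (abs_nonneg _)]
    calc (2 * Real.pi) ^ (α : ℝ) * |ξ| ^ (α : ℝ) * ‖𝓕 F ξ‖
        ≤ (2 * Real.pi) ^ (α : ℝ) * (1 + ‖ξ‖) ^ ⌈(α : ℝ)⌉₊ * ∫ x, ‖F x‖ := by gcongr
      _ = _ := by ring

/-- The fractional derivative `D^α F` of an integrable function `F`: the tempered distribution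
whose Fourier transform is `(2π|ξ|)^α 𝓕F(ξ)`. -/
noncomputable def fracDeriv (α : ℝ≥0) (F : ℝ → ℂ) : 𝓢'(ℝ, ℂ) :=
  𝓕⁻ (polyGrowth_fracSymbol α F).toDistribution

/-- The defining formula `𝓕(D^α F)(ξ) = (2π|ξ|)^α 𝓕F(ξ)`. -/
theorem fourier_fracDeriv_apply (α : ℝ≥0) (F : ℝ → ℂ) (φ : 𝓢(ℝ, ℂ)) :
    (𝓕 (fracDeriv α F)) φ =
      ∫ ξ, φ ξ • ((((2 * Real.pi * |ξ|) ^ (α : ℝ) : ℝ) : ℂ) * 𝓕 F ξ) := by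
  rw [fracDeriv, FourierTransform.fourier_fourierInv_eq]
  rfl

open scoped Classical in
/-- The `r`-variation seminorm `V_r(F(t) : t ∈ ℝ)`, with values in `[0, ∞]`: the supremum of
`(∑_{j < J} |F(t_{j+1}) - F(t_j)|^r)^{1/r}` over all finite increasing sequences
`t_0 < ⋯ < t_J`, and `sup_{s,t} |F(t) - F(s)|` when `r = ∞`. -/
noncomputable def rVariation (r : ℝ≥0∞) (F : ℝ → ℂ) : ℝ≥0∞ :=
  if r = ∞ then ⨆ (s : ℝ) (t : ℝ), ‖F t - F s‖ₑ
  else ⨆ (J : ℕ) (t : Fin (J + 1) → ℝ) (_ : StrictMono t),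
    (∑ j : Fin J, ‖F (t j.succ) - F (t j.castSucc)‖ₑ ^ r.toReal) ^ (1 / r.toReal)

/-!
The exponent `1/r` is critical because the convolution with a kernel at scale `1/a` costs a factor
`a^{1/r}` in the `r`-variation, and because a function of finite `r`-variation has `L^r` modulus of
continuity `O(|y|^{1/r})`.

From `D^α F` to the variation (`α > 1/r`). If `K` is integrable and of bounded variation, Hölder's
inequality applied to the increments of `K` gives
`V_r(K * h) ≤ (2‖K‖₁)^{1-1/r} V_1(K)^{1/r} ‖h‖_r` (`rVariation_convolution_le`). Split `F` smoothly
into a part of frequency `O(1)` and pieces `u_k` of frequency about `2^k`, `k ≥ 1`. The first part is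
a convolution of `F` with a Schwartz function; each `u_k` is `2^{-kα}` times the convolution of
`D^α F` with an `L¹`-normalized dilate of one Schwartz function, because the symbol of `D^α` is smooth
and nonzero away from the origin (`fourierInv_mul_fracSymbol_eq_convolution`). Hence
`V_r(u_k) = O(2^{k(1/r-α)} ‖D^α F‖_r)`, a summable bound. As `u_k` vanishes at infinity, `V_r(u_k)` also
bounds its supremum, so the series converges uniformly to a continuous function, which equals `F`
almost everywhere since the partial sums converge to `F` weakly. Lower semicontinuity of the variation
finishes the argument.

From the variation to `D^β F` (`β < 1/r`, so that `r < ∞`). For `β > 0` the function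
`g(x) = c ∫ (F(x) - F(x - y)) |y|^{-1-β} dy` is the required one, for a suitable constant `c`. Averaging
the variation sums along progressions of step `y` gives `‖F - F(· - y)‖_r ≤ V_r(F) |y|^{1/r}`
(`eLpNorm_sub_translate_le`), and Minkowski's inequality bounds `‖g‖_r`, the integral converging at `0`
because `β < 1/r` and at infinity because `β > 0`. Compact support gives the same bound in `L¹`, so
Fubini's theorem computes the Fourier transform of `g`; its symbol is homogeneous of degree `β`
and does not vanish, the real part of its integrand at `1` being `(1 - cos 2πy) |y|^{-1-β}`
(`fourier_singularIntegral`, `singularSymbol_eq_rpow_mul`, `singularSymbol_one_ne_zero`).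
-/

/-! ### A weighted power mean inequality -/

/-- Hölder's inequality for a weight `w`, in the form `(∫ w h)^s ≤ (∫ w)^(s-1) ∫ w h^s`. -/
theorem rpow_lintegral_mul_le {X : Type*} [MeasurableSpace X] {μ : Measure X} {s : ℝ} (hs : 1 ≤ s)
    {w h : X → ℝ≥0∞} (hw : AEMeasurable w μ) (hh : AEMeasurable h μ) :
    (∫⁻ x, w x * h x ∂μ) ^ s ≤ (∫⁻ x, w x ∂μ) ^ (s - 1) * ∫⁻ x, w x * h x ^ s ∂μ := by
  have hs0 : 0 < s := by linarith
  have hinv : 0 ≤ 1 - s⁻¹ := by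
    have := inv_le_one_of_one_le₀ hs
    linarith
  have key := ENNReal.lintegral_mul_norm_pow_le hw (hw.mul (hh.pow_const s)) hinv
    (inv_nonneg.2 hs0.le) (by ring)
  have h1 : ∀ x, w x * h x = w x ^ (1 - s⁻¹) * (w x * h x ^ s) ^ s⁻¹ := fun x => by
    rw [ENNReal.mul_rpow_of_nonneg _ _ (inv_nonneg.2 hs0.le), ← mul_assoc,
      ← ENNReal.rpow_add_of_nonneg _ _ hinv (inv_nonneg.2 hs0.le), ← ENNReal.rpow_mul,
      mul_inv_cancel₀ hs0.ne']
    simp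
  simp only [Pi.mul_apply] at key
  calc (∫⁻ x, w x * h x ∂μ) ^ s
      ≤ ((∫⁻ x, w x ∂μ) ^ (1 - s⁻¹) * (∫⁻ x, w x * h x ^ s ∂μ) ^ s⁻¹) ^ s := by
        gcongr
        simp_rw [h1 _]
        simpa only [← h1] using key
    _ = _ := by
        rw [ENNReal.mul_rpow_of_nonneg _ _ hs0.le, ← ENNReal.rpow_mul, ← ENNReal.rpow_mul,
          inv_mul_cancel₀ hs0.ne', ENNReal.rpow_one]
        congr 2
        field_simp

/-! ### The variation seminorm -/

section Variation

variable {r : ℝ≥0∞}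

theorem one_le_toReal (hr : 1 ≤ r) (hr' : r ≠ ∞) : 1 ≤ r.toReal := by
  rw [← ENNReal.toReal_one]
  exact ENNReal.toReal_mono hr' hr

theorem rVariation_top (F : ℝ → ℂ) : rVariation ∞ F = ⨆ (s : ℝ) (t : ℝ), ‖F t - F s‖ₑ :=
  if_pos rfl

theorem rVariation_of_ne_top (hr : r ≠ ∞) (F : ℝ → ℂ) :
    rVariation r F = ⨆ (J : ℕ) (t : Fin (J + 1) → ℝ) (_ : StrictMono t),
      (∑ j : Fin J, ‖F (t j.succ) - F (t j.castSucc)‖ₑ ^ r.toReal) ^ (1 / r.toReal) :=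
  if_neg hr

theorem rVariation_le (hr : r ≠ ∞) {F : ℝ → ℂ} {B : ℝ≥0∞}
    (h : ∀ (J : ℕ) (t : Fin (J + 1) → ℝ), StrictMono t →
      (∑ j : Fin J, ‖F (t j.succ) - F (t j.castSucc)‖ₑ ^ r.toReal) ^ (1 / r.toReal) ≤ B) :
    rVariation r F ≤ B := by
  rw [rVariation_of_ne_top hr]
  exact iSup_le fun J => iSup_le fun t => iSup_le fun ht => h J t ht

theorem sum_rpow_le_rVariation (hr : r ≠ ∞) (F : ℝ → ℂ) {J : ℕ} {t : Fin (J + 1) → ℝ}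
    (ht : StrictMono t) :
    (∑ j : Fin J, ‖F (t j.succ) - F (t j.castSucc)‖ₑ ^ r.toReal) ^ (1 / r.toReal)
      ≤ rVariation r F := by
  rw [rVariation_of_ne_top hr]
  exact le_iSup_of_le J (le_iSup_of_le t (le_iSup_of_le ht le_rfl))

theorem sum_le_rVariation_one (F : ℝ → ℂ) {J : ℕ} {t : Fin (J + 1) → ℝ} (ht : StrictMono t) :
    ∑ j : Fin J, ‖F (t j.succ) - F (t j.castSucc)‖ₑ ≤ rVariation 1 F := by
  simpa using sum_rpow_le_rVariation ENNReal.one_ne_top F ht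

theorem enorm_sub_le_rVariation (hr : 1 ≤ r) (F : ℝ → ℂ) (s t : ℝ) :
    ‖F t - F s‖ₑ ≤ rVariation r F := by
  rcases eq_or_ne r ∞ with rfl | hr'
  · rw [rVariation_top]
    exact le_iSup_of_le s (le_iSup_of_le t le_rfl)
  have hs0 : r.toReal ≠ 0 := (ENNReal.toReal_pos (by positivity) hr').ne'
  have aux : ∀ a b : ℝ, a < b → ‖F b - F a‖ₑ ≤ rVariation r F := fun a b hab => by
    have hm : StrictMono (![a, b] : Fin 2 → ℝ) := by
      rw [Fin.strictMono_iff_lt_succ]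
      intro i
      fin_cases i
      simpa using hab
    have := sum_rpow_le_rVariation hr' F hm
    simpa [← ENNReal.rpow_mul, mul_inv_cancel₀ hs0] using this
  rcases lt_trichotomy s t with h | rfl | h
  · exact aux s t h
  · simp
  · rw [enorm_sub_rev]
    exact aux t s h

theorem rVariation_add_le (hr : 1 ≤ r) (F G : ℝ → ℂ) :
    rVariation r (fun x => F x + G x) ≤ rVariation r F + rVariation r G := by
  have tri : ∀ s t : ℝ, ‖F t + G t - (F s + G s)‖ₑ ≤ ‖F t - F s‖ₑ + ‖G t - G s‖ₑ := fun s t => by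
    rw [add_sub_add_comm]
    exact enorm_add_le _ _
  rcases eq_or_ne r ∞ with rfl | hr'
  · rw [rVariation_top]
    exact iSup_le fun s => iSup_le fun t => (tri s t).trans
      (add_le_add (enorm_sub_le_rVariation hr F s t) (enorm_sub_le_rVariation hr G s t))
  have hs : 1 ≤ r.toReal := one_le_toReal hr hr'
  refine rVariation_le hr' fun J t ht => ?_
  refine le_trans ?_ (add_le_add (sum_rpow_le_rVariation hr' F ht)
    (sum_rpow_le_rVariation hr' G ht))
  refine le_trans ?_ (ENNReal.Lp_add_le _ _ _ hs)
  gcongr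
  exact tri _ _

/-- The variation is lower semicontinuous under pointwise convergence. -/
theorem rVariation_le_of_tendsto (hr : 1 ≤ r) {F : ℕ → ℝ → ℂ} {G : ℝ → ℂ} {B : ℝ≥0∞}
    (hF : ∀ x, Filter.Tendsto (fun n => F n x) Filter.atTop (nhds (G x)))
    (hB : ∀ n, rVariation r (F n) ≤ B) : rVariation r G ≤ B := by
  rcases eq_or_ne r ∞ with rfl | hr'
  · rw [rVariation_top]
    refine iSup_le fun s => iSup_le fun t => le_of_tendsto' ((hF t).sub (hF s)).enorm fun n => ?_
    exact (enorm_sub_le_rVariation hr (F n) s t).trans (hB n)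
  refine rVariation_le hr' fun J t ht => ?_
  have hlim : Filter.Tendsto
      (fun n => (∑ j : Fin J, ‖F n (t j.succ) - F n (t j.castSucc)‖ₑ ^ r.toReal) ^ (1 / r.toReal))
      Filter.atTop
      (nhds ((∑ j : Fin J, ‖G (t j.succ) - G (t j.castSucc)‖ₑ ^ r.toReal) ^ (1 / r.toReal))) :=
    (tendsto_finsetSum _ fun j _ =>
      ((hF (t j.succ)).sub (hF (t j.castSucc))).enorm.ennrpow_const _).ennrpow_const _
  exact le_of_tendsto' hlim fun n => (sum_rpow_le_rVariation hr' (F n) ht).trans (hB n)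

theorem rVariation_sum_le (hr : 1 ≤ r) (u : ℕ → ℝ → ℂ) (N : ℕ) :
    rVariation r (fun x => ∑ k ∈ Finset.range (N + 1), u k x)
      ≤ ∑ k ∈ Finset.range (N + 1), rVariation r (u k) := by
  induction N with
  | zero => simp
  | succ N ih =>
    simp only [Finset.sum_range_succ _ (N + 1)]
    exact (rVariation_add_le hr _ _).trans (by gcongr)

/-- A convolution `K * h` inherits finite `r`-variation from `h ∈ L^r` when `K` is integrable and of
bounded variation. Hölder's inequality is applied to each increment of `K`; the increments are
then summed under the integral sign, where they add up to at most the variation of `K`. For `r = ∞`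
the junk value `r.toReal = 0` gives the exponents `1` and `0`, which are the right ones. -/
theorem rVariation_convolution_le (hr : 1 ≤ r) {K h : ℝ → ℂ} (hK : Continuous K)
    (hh : AEStronglyMeasurable h) (hint : ∀ x, Integrable fun y => K (x - y) * h y) :
    rVariation r (fun x => ∫ y, K (x - y) * h y)
      ≤ (2 * ∫⁻ x, ‖K x‖ₑ) ^ (1 - 1 / r.toReal) * rVariation 1 K ^ (1 / r.toReal)
        * eLpNorm h r := by
  set A := ∫⁻ x, ‖K x‖ₑ with hA
  have hw : ∀ s t : ℝ, Measurable fun y => ‖K (t - y) - K (s - y)‖ₑ := fun s t =>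
    (by fun_prop : Continuous fun y => K (t - y) - K (s - y)).enorm.measurable
  have hwA : ∀ s t : ℝ, ∫⁻ y, ‖K (t - y) - K (s - y)‖ₑ ≤ 2 * A := fun s t => calc
    _ ≤ ∫⁻ y, (‖K (t - y)‖ₑ + ‖K (s - y)‖ₑ) := lintegral_mono fun y => enorm_sub_le
    _ = 2 * A := by
      rw [lintegral_add_left
        (by fun_prop : Continuous fun y => K (t - y)).enorm.measurable, lintegral_sub_left_eq_self (fun y => ‖K y‖ₑ) t,
        lintegral_sub_left_eq_self (fun y => ‖K y‖ₑ) s, two_mul]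
  have hdiff : ∀ s t : ℝ, ‖(∫ y, K (t - y) * h y) - ∫ y, K (s - y) * h y‖ₑ
      ≤ ∫⁻ y, ‖K (t - y) - K (s - y)‖ₑ * ‖h y‖ₑ := fun s t => by
    rw [← integral_sub (hint t) (hint s)]
    refine (enorm_integral_le_lintegral_enorm _).trans_eq (lintegral_congr fun y => ?_)
    rw [← sub_mul, enorm_mul]
  rcases eq_or_ne r ∞ with rfl | hr'
  · rw [rVariation_top]
    simp only [ENNReal.toReal_top, div_zero, sub_zero, ENNReal.rpow_one, ENNReal.rpow_zero, mul_one]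
    refine iSup_le fun s => iSup_le fun t => (hdiff s t).trans ?_
    calc ∫⁻ y, ‖K (t - y) - K (s - y)‖ₑ * ‖h y‖ₑ
        ≤ ∫⁻ y, ‖K (t - y) - K (s - y)‖ₑ * eLpNorm h ∞ := by
          refine lintegral_mono_ae ?_
          filter_upwards [ae_le_eLpNormEssSup (f := h) (μ := volume)] with y hy
          gcongr
          simpa using hy
      _ ≤ _ := by
          rw [lintegral_mul_const _ (hw s t)]
          gcongr
          exact hwA s t
  have hs : 1 ≤ r.toReal := one_le_toReal hr hr'
  have hs0 : 0 < r.toReal := by linarith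
  refine rVariation_le hr' fun J t ht => ?_
  set s := r.toReal with hs_def
  have hsum : ∑ j : Fin J, ‖(∫ y, K (t j.succ - y) * h y) - ∫ y, K (t j.castSucc - y) * h y‖ₑ ^ s
      ≤ (2 * A) ^ (s - 1) * (rVariation 1 K * ∫⁻ y, ‖h y‖ₑ ^ s) := calc
    _ ≤ ∑ j : Fin J, (2 * A) ^ (s - 1) *
          ∫⁻ y, ‖K (t j.succ - y) - K (t j.castSucc - y)‖ₑ * ‖h y‖ₑ ^ s := by
      refine Finset.sum_le_sum fun j _ => ?_
      refine (ENNReal.rpow_le_rpow (hdiff _ _) hs0.le).trans ?_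
      refine (rpow_lintegral_mul_le hs (hw _ _).aemeasurable hh.enorm).trans ?_
      gcongr
      exact hwA _ _
    _ = (2 * A) ^ (s - 1) *
          ∫⁻ y, (∑ j : Fin J, ‖K (t j.succ - y) - K (t j.castSucc - y)‖ₑ) * ‖h y‖ₑ ^ s := by
      rw [← Finset.mul_sum]
      congr 1
      simp only [Finset.sum_mul]
      exact (lintegral_finsetSum' _ fun j _ =>
        (hw _ _).aemeasurable.mul (hh.enorm.pow_const s)).symm
    _ ≤ (2 * A) ^ (s - 1) * ∫⁻ y, rVariation 1 K * ‖h y‖ₑ ^ s := by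
      gcongr with y
      exact sum_le_rVariation_one K (t := fun j => t j - y) fun i j hij =>
        sub_lt_sub_right (ht hij) y
    _ = _ := by rw [lintegral_const_mul'' _ (hh.enorm.pow_const s)]
  calc _ ≤ ((2 * A) ^ (s - 1) * (rVariation 1 K * ∫⁻ y, ‖h y‖ₑ ^ s)) ^ (1 / s) := by gcongr
    _ = _ := by
      have hexp : (s - 1) * (1 / s) = 1 - 1 / s := by field_simp
      rw [ENNReal.mul_rpow_of_nonneg ((2 * A) ^ (s - 1)) _ (by positivity),
        ENNReal.mul_rpow_of_nonneg (rVariation 1 K) _ (by positivity), ← ENNReal.rpow_mul,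
        eLpNorm_eq_lintegral_rpow_enorm_toReal (by positivity) hr', ← mul_assoc, hexp]

theorem rVariation_const_mul_comp_mul_le (hr : 1 ≤ r) (K : ℝ → ℂ) (c : ℂ) {a : ℝ} (ha : 0 < a) :
    rVariation r (fun x => c * K (a * x)) ≤ ‖c‖ₑ * rVariation r K := by
  rcases eq_or_ne r ∞ with rfl | hr'
  · rw [rVariation_top]
    simp only [← mul_sub, enorm_mul]
    exact iSup_le fun s => iSup_le fun t => by
      gcongr
      exact enorm_sub_le_rVariation hr K _ _
  have hs0 : 0 < r.toReal := ENNReal.toReal_pos (by positivity) hr'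
  refine rVariation_le hr' fun J t ht => ?_
  simp only [← mul_sub, enorm_mul, ENNReal.mul_rpow_of_nonneg _ _ hs0.le]
  rw [← Finset.mul_sum, ENNReal.mul_rpow_of_nonneg _ _ (by positivity), ← ENNReal.rpow_mul,
    mul_one_div_cancel hs0.ne', ENNReal.rpow_one]
  gcongr
  exact sum_rpow_le_rVariation hr' K (t := fun j => a * t j) fun i j hij =>
    mul_lt_mul_of_pos_left (ht hij) ha

/-- A Schwartz function has bounded variation: its increments are controlled by those of the
primitive of `‖f'‖`. -/
theorem SchwartzMap.rVariation_one_lt_top (f : 𝓢(ℝ, ℂ)) : rVariation 1 f < ∞ := by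
  have hd : Integrable (deriv f) := (SchwartzMap.derivCLM ℂ ℂ f).integrable
  refine lt_of_le_of_lt (rVariation_le ENNReal.one_ne_top (B := ENNReal.ofReal (∫ x, ‖deriv f x‖))
    fun J t ht => ?_) ENNReal.ofReal_lt_top
  simp only [ENNReal.toReal_one, div_one, ENNReal.rpow_one]
  have hinc : ∀ a b : ℝ, a ≤ b → ‖f b - f a‖ ≤ ∫ x in a..b, ‖deriv f x‖ := fun a b hab => by
    rw [← intervalIntegral.integral_eq_sub_of_hasDerivAt
      (fun x _ => (f.differentiable x).hasDerivAt) hd.intervalIntegrable]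
    exact intervalIntegral.norm_integral_le_integral_norm hab
  have htel : ∀ (J : ℕ) (t : Fin (J + 1) → ℝ), StrictMono t →
      ∑ j : Fin J, ‖f (t j.succ) - f (t j.castSucc)‖ ≤ ∫ x in t 0..t (Fin.last J), ‖deriv f x‖ := by
    intro J
    induction J with
    | zero => intro t _; simp
    | succ J ih =>
      intro t ht
      rw [Fin.sum_univ_castSucc]
      have h1 := ih (fun j => t j.castSucc) (ht.comp (Fin.strictMono_castSucc))
      have h2 := hinc (t (Fin.last J).castSucc) (t (Fin.last J).succ)
        (ht.monotone (Fin.castSucc_le_succ _))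
      refine (add_le_add h1 h2).trans_eq ?_
      exact intervalIntegral.integral_add_adjacent_intervals hd.norm.intervalIntegrable
        hd.norm.intervalIntegrable
  have h0 : ∑ j : Fin J, ‖f (t j.succ) - f (t j.castSucc)‖ ≤ ∫ x, ‖deriv f x‖ := by
    refine (htel J t ht).trans ?_
    rw [intervalIntegral.integral_of_le (ht.monotone (Fin.zero_le _))]
    exact setIntegral_le_integral hd.norm (Filter.Eventually.of_forall fun _ => norm_nonneg _)
  calc ∑ j : Fin J, ‖f (t j.succ) - f (t j.castSucc)‖ₑ
      = ENNReal.ofReal (∑ j : Fin J, ‖f (t j.succ) - f (t j.castSucc)‖) := by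
        rw [ENNReal.ofReal_sum_of_nonneg fun _ _ => norm_nonneg _]
        simp
    _ ≤ _ := ENNReal.ofReal_le_ofReal h0

end Variation

/-! ### Fractional derivatives given by functions -/

theorem integral_fourier_mul_eq {f g : ℝ → ℂ} (hf : Integrable f) (hg : Integrable g) :
    ∫ ξ, 𝓕 f ξ * g ξ = ∫ x, f x * 𝓕 g x := by
  simpa using! VectorFourier.integral_fourierIntegral_smul_eq_flip (L := innerₗ ℝ)
    Real.continuous_fourierChar continuous_inner hf hg

theorem integral_fourierInv_mul_eq {f g : ℝ → ℂ} (hf : Integrable f) (hg : Integrable g) :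
    ∫ ξ, 𝓕⁻ f ξ * g ξ = ∫ x, f x * 𝓕⁻ g x := by
  rw [Real.fourierInv_eq_fourier_comp_neg g, ← integral_fourier_mul_eq hf hg.comp_neg,
    ← integral_neg_eq_self]
  simp only [Real.fourierInv_eq_fourier_neg, neg_neg]

theorem fourierInv_real_eq (f : ℝ → ℂ) (x : ℝ) :
    𝓕⁻ f x = ∫ ξ, Real.fourierChar (ξ * x) • f ξ := by
  simp only [Real.fourierInv_eq, RCLike.inner_apply, conj_trivial, mul_comm]

theorem continuous_fourier_of_integrable {f : ℝ → ℂ} (hf : Integrable f) : Continuous (𝓕 f) :=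
  VectorFourier.fourierIntegral_continuous Real.continuous_fourierChar (by fun_prop) hf

theorem continuous_fourierInv_of_integrable {f : ℝ → ℂ} (hf : Integrable f) :
    Continuous (𝓕⁻ f) := by
  rw [Real.fourierInv_eq_fourier_comp_neg]
  exact continuous_fourier_of_integrable hf.comp_neg

theorem norm_fourier_le_integral_norm (f : ℝ → ℂ) (ξ : ℝ) : ‖𝓕 f ξ‖ ≤ ∫ x, ‖f x‖ :=
  VectorFourier.norm_fourierIntegral_le_integral_norm _ _ _ _ _

theorem integrable_of_memLp_of_hasCompactSupport {r : ℝ≥0∞} (hr : 1 ≤ r) {F : ℝ → ℂ}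
    (hF : MemLp F r) (hc : HasCompactSupport F) : Integrable F :=
  (integrableOn_iff_integrable_of_support_subset (subset_tsupport F)).1
    ((hF.locallyIntegrable hr).integrableOn_isCompact hc)

section Distribution

variable {r : ℝ≥0∞} [Fact (1 ≤ r)]

theorem integral_smul_eq_of_eq_fracDeriv {α : ℝ≥0} {F : ℝ → ℂ}
    {g : Lp ℂ r (volume : Measure ℝ)} (hg : (g : 𝓢'(ℝ, ℂ)) = fracDeriv α F) (φ : 𝓢(ℝ, ℂ)) :
    ∫ x, φ x * g x = ∫ ξ, 𝓕⁻ (φ : ℝ → ℂ) ξ * fracSymbol α F ξ := by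
  have h := congrArg (fun T : 𝓢'(ℝ, ℂ) => T φ) hg
  simp only [Lp.toTemperedDistribution_apply, smul_eq_mul] at h
  rw [h, fracDeriv, TemperedDistribution.fourierInv_apply, PolyGrowth.toDistribution_apply,
    SchwartzMap.fourierInv_coe]
  rfl

theorem toLp_eq_fracDeriv {β : ℝ≥0} {F g : ℝ → ℂ} (hg : MemLp g r) (hi : Integrable g)
    (h : 𝓕 g = fracSymbol β F) : ((hg.toLp g : Lp ℂ r) : 𝓢'(ℝ, ℂ)) = fracDeriv β F := by
  ext φ
  rw [Lp.toTemperedDistribution_apply, fracDeriv, TemperedDistribution.fourierInv_apply,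
    PolyGrowth.toDistribution_apply, ← h]
  simp only [smul_eq_mul]
  rw [← integral_fourier_mul_eq (𝓕⁻ φ).integrable hi, ← SchwartzMap.fourier_coe,
    FourierTransform.fourier_fourierInv_eq]
  refine integral_congr_ae ?_
  filter_upwards [hg.coeFn_toLp] with x hx
  rw [hx]

theorem fracSymbol_zero (F : ℝ → ℂ) : fracSymbol 0 F = 𝓕 F := by
  funext ξ
  simp [fracSymbol]

/-! ### Smooth frequency cut-offs -/

/-- A smooth frequency cut-off of `F` at scale `a` is a convolution of `D^α F` with a dilate of a
fixed Schwartz function. -/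
theorem fourierInv_mul_fracSymbol_eq_convolution (ψ : 𝓢(ℝ, ℂ)) {α : ℝ≥0} {F : ℝ → ℂ}
    {g : Lp ℂ r (volume : Measure ℝ)} (hg : (g : 𝓢'(ℝ, ℂ)) = fracDeriv α F) {a : ℝ} (ha : 0 < a)
    (x : ℝ) :
    Integrable (fun y => (a * 𝓕⁻ ψ (a * (x - y)) : ℂ) * g y) ∧
    𝓕⁻ (fun ξ => ψ (a⁻¹ * ξ) * fracSymbol α F ξ) x
      = ∫ y, (a * 𝓕⁻ ψ (a * (x - y)) : ℂ) * g y := by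
  have hanti : AntilipschitzWith ‖a‖₊⁻¹ (fun y : ℝ => a * (x - y)) :=
    AntilipschitzWith.of_le_mul_dist fun y z => by
      rw [Real.dist_eq, Real.dist_eq, ← mul_sub, sub_sub_sub_cancel_left, abs_mul, abs_sub_comm z y,
        NNReal.coe_inv, coe_nnnorm, Real.norm_eq_abs, inv_mul_cancel_left₀ (abs_pos.2 ha.ne').ne']
  set φ : 𝓢(ℝ, ℂ) := (a : ℂ) • compCLMOfAntilipschitz ℂ
    (by fun_prop : Function.HasTemperateGrowth fun y : ℝ => a * (x - y)) hanti (𝓕⁻ ψ) with hφ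
  have hφy : ∀ y, φ y = a * 𝓕⁻ ψ (a * (x - y)) := fun y => rfl
  have hfour : ∀ ξ, 𝓕⁻ (φ : ℝ → ℂ) ξ = Real.fourierChar (ξ * x) • ψ (a⁻¹ * ξ) := fun ξ => by
    have hsub : ∫ y, (a : ℂ) * (Real.fourierChar ((x - a⁻¹ * (a * (x - y))) * ξ) •
        𝓕⁻ ψ (a * (x - y))) = ∫ z, Real.fourierChar ((x - a⁻¹ * z) * ξ) • 𝓕⁻ ψ z := by
      rw [integral_const_mul, integral_sub_left_eq_self (fun y =>
        Real.fourierChar ((x - a⁻¹ * (a * y)) * ξ) • 𝓕⁻ ψ (a * y)) volume x,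
        Measure.integral_comp_mul_left
          (fun z => Real.fourierChar ((x - a⁻¹ * z) * ξ) • 𝓕⁻ ψ z), abs_of_pos (inv_pos.2 ha),
        Complex.real_smul, ← mul_assoc, ← Complex.ofReal_mul, mul_inv_cancel₀ ha.ne',
        Complex.ofReal_one, one_mul]
    have hinv : ψ (a⁻¹ * ξ) = ∫ z, Real.fourierChar (-(z * (a⁻¹ * ξ))) • 𝓕⁻ ψ z := by
      rw [← Real.fourier_real_eq, ← SchwartzMap.fourier_coe,
        FourierTransform.fourier_fourierInv_eq]
    calc 𝓕⁻ (φ : ℝ → ℂ) ξ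
        = ∫ y, Real.fourierChar (y * ξ) • φ y := fourierInv_real_eq _ _
      _ = ∫ z, Real.fourierChar ((x - a⁻¹ * z) * ξ) • 𝓕⁻ ψ z := by
        rw [← hsub]
        refine integral_congr_ae (Filter.Eventually.of_forall fun y => ?_)
        simp only [hφy, inv_mul_cancel_left₀ ha.ne', sub_sub_cancel, Circle.smul_def,
          smul_eq_mul]
        ring
      _ = ∫ z, Real.fourierChar (ξ * x) • (Real.fourierChar (-(z * (a⁻¹ * ξ))) • 𝓕⁻ ψ z) := by
        refine integral_congr_ae (Filter.Eventually.of_forall fun z => ?_)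
        simp only [smul_smul, ← AddChar.map_add_eq_mul]
        ring_nf
      _ = _ := by
        simp only [Circle.smul_def (Real.fourierChar (ξ * x))]
        rw [integral_smul, hinv]
  refine ⟨?_, ?_⟩
  · have := ENNReal.HolderConjugate.inv_one_sub_inv' (Fact.out : 1 ≤ r)
    simp only [← hφy]
    exact MemLp.integrable_mul (p := (1 - r⁻¹)⁻¹) (q := r) (φ.memLp _ volume) (Lp.memLp g)
  · simp only [← hφy]
    rw [integral_smul_eq_of_eq_fracDeriv hg φ, fourierInv_real_eq]
    refine integral_congr_ae (Filter.Eventually.of_forall fun ξ => ?_)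
    simp only [hfour, smul_mul_assoc]

/-- A frequency cut-off at scale `a` costs a factor `a^{1/r}` in the `r`-variation. -/
theorem exists_rVariation_fourierInv_mul_fracSymbol_le (r : ℝ≥0∞) [Fact (1 ≤ r)]
    (ψ : 𝓢(ℝ, ℂ)) : ∃ C : ℝ≥0, ∀ (α : ℝ≥0) (F : ℝ → ℂ) (g : Lp ℂ r (volume : Measure ℝ)),
      (g : 𝓢'(ℝ, ℂ)) = fracDeriv α F → ∀ a : ℝ, 0 < a →
        rVariation r (𝓕⁻ fun ξ => ψ (a⁻¹ * ξ) * fracSymbol α F ξ)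
          ≤ C * ENNReal.ofReal (a ^ (1 / r.toReal)) * eLpNorm g r := by
  have hr : 1 ≤ r := Fact.out
  have hexp : 0 ≤ 1 - 1 / r.toReal := by
    rcases eq_or_ne r ∞ with rfl | hr'
    · simp
    have : 1 ≤ r.toReal := one_le_toReal hr hr'
    rw [sub_nonneg, div_le_one (by linarith)]
    exact this
  set Ψ : 𝓢(ℝ, ℂ) := 𝓕⁻ ψ
  set B := (2 * ∫⁻ x, ‖Ψ x‖ₑ) ^ (1 - 1 / r.toReal) * rVariation 1 Ψ ^ (1 / r.toReal) with hB
  have hBfin : B ≠ ∞ := ENNReal.mul_ne_top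
    (ENNReal.rpow_ne_top_of_nonneg hexp
      (ENNReal.mul_ne_top ENNReal.ofNat_ne_top Ψ.integrable.2.ne))
    (ENNReal.rpow_ne_top_of_nonneg (by positivity) Ψ.rVariation_one_lt_top.ne)
  refine ⟨B.toNNReal, fun α F g hg a ha => ?_⟩
  have hL1 : ∫⁻ x, ‖(a : ℂ) * Ψ (a * x)‖ₑ = ∫⁻ x, ‖Ψ x‖ₑ := by
    rw [← ofReal_integral_norm_eq_lintegral_enorm Ψ.integrable,
      ← ofReal_integral_norm_eq_lintegral_enorm
        ((Ψ.integrable.comp_mul_left' ha.ne').const_mul _)]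
    simp only [norm_mul, integral_const_mul, Complex.norm_real, Real.norm_of_nonneg ha.le]
    rw [Measure.integral_comp_mul_left (fun x => ‖Ψ x‖), abs_of_pos (inv_pos.2 ha), smul_eq_mul,
      mul_inv_cancel_left₀ ha.ne']
  have hV := rVariation_const_mul_comp_mul_le le_rfl Ψ (a : ℂ) ha
  have h := rVariation_convolution_le hr (K := fun x => (a : ℂ) * Ψ (a * x)) (h := g)
    (by fun_prop) (Lp.aestronglyMeasurable g)
    fun x => (fourierInv_mul_fracSymbol_eq_convolution ψ hg ha x).1
  rw [hL1] at h
  have heq : (𝓕⁻ fun ξ => ψ (a⁻¹ * ξ) * fracSymbol α F ξ)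
      = fun x => ∫ y, (a * Ψ (a * (x - y)) : ℂ) * g y :=
    funext fun x => (fourierInv_mul_fracSymbol_eq_convolution ψ hg ha x).2
  rw [heq, ENNReal.coe_toNNReal hBfin, hB]
  refine h.trans ?_
  calc _ ≤ (2 * ∫⁻ x, ‖Ψ x‖ₑ) ^ (1 - 1 / r.toReal) * (‖(a : ℂ)‖ₑ * rVariation 1 Ψ)
            ^ (1 / r.toReal) * eLpNorm g r := by gcongr
    _ = _ := by
      rw [ENNReal.mul_rpow_of_nonneg ‖(a : ℂ)‖ₑ _ (by positivity), ← ofReal_norm,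
        Complex.norm_real, Real.norm_of_nonneg ha.le,
        ENNReal.ofReal_rpow_of_nonneg ha.le (by positivity)]
      ring

end Distribution

/-! ### The Littlewood–Paley decomposition -/

theorem exists_schwartz_cutoff : ∃ χ : 𝓢(ℝ, ℂ), HasCompactSupport χ ∧ (∀ ξ, ‖χ ξ‖ ≤ 1) ∧
    ∀ ξ, |ξ| ≤ 1 → χ ξ = 1 := by
  let b : ContDiffBump (0 : ℝ) := ⟨1, 2, one_pos, one_lt_two⟩
  have hc : HasCompactSupport (Complex.ofRealCLM ∘ b) := b.hasCompactSupport.comp_left rfl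
  have hs : ContDiff ℝ (⊤ : ℕ∞) (Complex.ofRealCLM ∘ b) := Complex.ofRealCLM.contDiff.comp b.contDiff
  refine ⟨hc.toSchwartzMap hs, hc, fun ξ => ?_, fun ξ hξ => ?_⟩
  · change ‖((b ξ : ℝ) : ℂ)‖ ≤ 1
    rw [Complex.norm_real, Real.norm_of_nonneg b.nonneg]
    exact b.le_one
  · change ((b ξ : ℝ) : ℂ) = 1
    rw [b.one_of_mem_closedBall (by simpa using hξ), Complex.ofReal_one]

/-- The difference of two consecutive cut-offs vanishes near the origin, so that it may be divided
by the symbol of `D^α`. -/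
theorem exists_schwartz_mul_symbol_eq (χ : 𝓢(ℝ, ℂ)) (hc : HasCompactSupport χ)
    (h1 : ∀ ξ, |ξ| ≤ 1 → χ ξ = 1) (α : ℝ) :
    ∃ ψ : 𝓢(ℝ, ℂ), ∀ ξ, ψ ξ * ((2 * Real.pi * |ξ|) ^ α : ℝ) = χ ξ - χ (2 * ξ) := by
  set f : ℝ → ℂ := fun ξ => (χ ξ - χ (2 * ξ)) * (((2 * Real.pi * |ξ|) ^ (-α) : ℝ) : ℂ) with hf
  have hfc : HasCompactSupport f :=
    (hc.sub (hc.comp_homeomorph (Homeomorph.mulLeft₀ (2 : ℝ) two_ne_zero))).mul_right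
  have hzero : ∀ ξ : ℝ, |ξ| < 1 / 2 → χ ξ - χ (2 * ξ) = 0 := fun ξ hξ => by
    rw [h1 ξ (by linarith), h1 (2 * ξ) (by rw [abs_mul, abs_two]; linarith), sub_self]
  have hfs : ContDiff ℝ (⊤ : ℕ∞) f := by
    rw [contDiff_iff_contDiffAt]
    intro ξ
    rcases eq_or_ne ξ 0 with rfl | hξ
    · refine (contDiffAt_const (c := (0 : ℂ))).congr_of_eventuallyEq ?_
      filter_upwards [Metric.ball_mem_nhds (0 : ℝ) (by norm_num : (0 : ℝ) < 1 / 2)] with η hη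
      simp only [hf]
      rw [hzero η (by simpa using hη), zero_mul]
    · have hpos : 0 < |ξ| := abs_pos.2 hξ
      refine ContDiffAt.mul ?_ ?_
      · exact (χ.smooth _).contDiffAt.sub
          (((χ.smooth _).comp (contDiff_const.mul contDiff_id)).contDiffAt)
      · exact Complex.ofRealCLM.contDiff.contDiffAt.comp ξ
          ((contDiffAt_const.mul (contDiffAt_abs hξ)).rpow_const_of_ne (by positivity))
  refine ⟨hfc.toSchwartzMap hfs, fun ξ => ?_⟩
  change f ξ * _ = _
  rcases eq_or_ne ξ 0 with rfl | hξ
  · simp [hf]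
  · have hpos : 0 < 2 * Real.pi * |ξ| := by positivity
    simp only [hf]
    rw [mul_assoc, ← Complex.ofReal_mul, ← Real.rpow_add hpos]
    simp

section

variable {r : ℝ≥0∞}

/-- A function vanishing at infinity is bounded by its variation. -/
theorem enorm_le_rVariation_of_tendsto_zero (hr : 1 ≤ r) {u : ℝ → ℂ}
    (hu : Filter.Tendsto u (Filter.cocompact ℝ) (nhds 0)) (x : ℝ) : ‖u x‖ₑ ≤ rVariation r u := by
  have h : Filter.Tendsto (fun s => ‖u x - u s‖ₑ) (Filter.cocompact ℝ) (nhds ‖u x - 0‖ₑ) :=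
    (tendsto_const_nhds.sub hu).enorm
  rw [sub_zero] at h
  exact le_of_tendsto' h fun s => enorm_sub_le_rVariation hr u s x

theorem tendsto_fourierInv_cocompact (f : ℝ → ℂ) :
    Filter.Tendsto (𝓕⁻ f) (Filter.cocompact ℝ) (nhds 0) := by
  rw [Real.fourierInv_eq_fourier_comp_neg]
  exact Real.zero_at_infty_fourier _

theorem integrable_cutoff_mul_fourier {χ : 𝓢(ℝ, ℂ)} (hc : HasCompactSupport χ) {F : ℝ → ℂ}
    (hF : Integrable F) (N : ℕ) : Integrable fun ξ => χ (((2 : ℝ) ^ N)⁻¹ * ξ) * 𝓕 F ξ := by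
  have hcont : Continuous fun ξ => χ (((2 : ℝ) ^ N)⁻¹ * ξ) * 𝓕 F ξ :=
    (by fun_prop : Continuous fun ξ => χ (((2 : ℝ) ^ N)⁻¹ * ξ)).mul
      (continuous_fourier_of_integrable hF)
  refine hcont.integrable_of_hasCompactSupport ?_
  exact (hc.comp_homeomorph
    (Homeomorph.mulLeft₀ (((2 : ℝ) ^ N)⁻¹) (by positivity))).mul_right

/-- The smoothed functions `𝓕⁻(χ(·/2^N) 𝓕F)` converge weakly to `F`. -/
theorem tendsto_integral_fourierInv_cutoff {χ : 𝓢(ℝ, ℂ)} (hc : HasCompactSupport χ)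
    (hle : ∀ ξ, ‖χ ξ‖ ≤ 1) (h1 : ∀ ξ, |ξ| ≤ 1 → χ ξ = 1) {F : ℝ → ℂ} (hF : Integrable F)
    (φ : 𝓢(ℝ, ℂ)) :
    Filter.Tendsto (fun N : ℕ => ∫ x, 𝓕⁻ (fun ξ => χ (((2 : ℝ) ^ N)⁻¹ * ξ) * 𝓕 F ξ) x * φ x)
      Filter.atTop (nhds (∫ x, F x * φ x)) := by
  have hlim : ∫ x, F x * φ x = ∫ ξ, 𝓕 F ξ * 𝓕⁻ (φ : ℝ → ℂ) ξ := by
    rw [← SchwartzMap.fourierInv_coe, integral_fourier_mul_eq hF (𝓕⁻ φ).integrable,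
      ← SchwartzMap.fourier_coe, FourierTransform.fourier_fourierInv_eq]
  simp only [integral_fourierInv_mul_eq (integrable_cutoff_mul_fourier hc hF _) φ.integrable]
  rw [hlim]
  simp only [← SchwartzMap.fourierInv_coe]
  have hFcont := continuous_fourier_of_integrable hF
  refine tendsto_integral_of_dominated_convergence (fun ξ => (∫ x, ‖F x‖) * ‖𝓕⁻ φ ξ‖)
    (fun N => ((integrable_cutoff_mul_fourier hc hF N).1.mul
      (𝓕⁻ φ).continuous.aestronglyMeasurable))
    ((𝓕⁻ φ).integrable.norm.const_mul _) (fun N => Filter.Eventually.of_forall fun ξ => ?_)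
    (Filter.Eventually.of_forall fun ξ => ?_)
  · rw [norm_mul, norm_mul]
    gcongr
    calc _ ≤ 1 * ∫ x, ‖F x‖ := by
          gcongr
          · exact hle _
          · exact norm_fourier_le_integral_norm F ξ
      _ = _ := one_mul _
  · refine Filter.Tendsto.mul_const _ ?_
    refine tendsto_const_nhds.congr' ?_
    have h0 : Filter.Tendsto (fun N : ℕ => |((2 : ℝ) ^ N)⁻¹ * ξ|) Filter.atTop (nhds 0) := by
      have := (tendsto_inv_atTop_zero.comp
        (tendsto_pow_atTop_atTop_of_one_lt (one_lt_two (α := ℝ)))).mul_const ξ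
      simpa using this.abs
    filter_upwards [h0.eventually_le_const one_pos] with N hN
    rw [h1 _ hN, one_mul]

/-- A series of continuous functions that vanish at infinity and have summable variations converges
uniformly, since each supremum is at most the variation; the variation of the sum is at most the
sum of the variations. -/
theorem exists_continuous_limit_rVariation_le (hr : 1 ≤ r) {u : ℕ → ℝ → ℂ} {b : ℕ → ℝ≥0∞}
    (hu : ∀ k, Continuous (u k)) (h0 : ∀ k, Filter.Tendsto (u k) (Filter.cocompact ℝ) (nhds 0))
    (hb : ∀ k, rVariation r (u k) ≤ b k) (hsum : ∑' k, b k ≠ ∞) :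
    ∃ G : ℝ → ℂ, Continuous G ∧ rVariation r G ≤ ∑' k, b k ∧
      (∀ x, Filter.Tendsto (fun N => ∑ k ∈ Finset.range (N + 1), u k x) Filter.atTop (nhds (G x))) ∧
      ∀ N x, ‖∑ k ∈ Finset.range (N + 1), u k x‖ ≤ ∑' k, (b k).toReal := by
  have hbfin : ∀ k, b k ≠ ∞ := ENNReal.ne_top_of_tsum_ne_top hsum
  have hs : Summable fun k => (b k).toReal := ENNReal.summable_toReal hsum
  have hle : ∀ k x, ‖u k x‖ ≤ (b k).toReal := fun k x => by
    rw [← toReal_enorm]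
    exact ENNReal.toReal_mono (hbfin k)
      ((enorm_le_rVariation_of_tendsto_zero hr (h0 k) x).trans (hb k))
  have hlim : ∀ x, Filter.Tendsto (fun N => ∑ k ∈ Finset.range (N + 1), u k x) Filter.atTop
      (nhds (∑' k, u k x)) := fun x =>
    (Filter.tendsto_add_atTop_iff_nat (f := fun N => ∑ k ∈ Finset.range N, u k x) 1).2
      (hs.of_norm_bounded (fun k => hle k x)).hasSum.tendsto_sum_nat
  refine ⟨fun x => ∑' k, u k x, continuous_tsum hu hs hle,
    rVariation_le_of_tendsto hr hlim fun N => ?_, hlim, fun N x => ?_⟩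
  · refine (rVariation_sum_le hr u N).trans ?_
    exact (Finset.sum_le_sum fun k _ => hb k).trans (ENNReal.sum_le_tsum _)
  · refine (norm_sum_le _ _).trans ?_
    exact (Finset.sum_le_sum fun k _ => hle k x).trans
      (hs.sum_le_tsum _ fun k _ => ENNReal.toReal_nonneg)

/-- Above the critical exponent `1/r`, the derivative `D^α` controls the `r`-variation. The
Littlewood–Paley piece of `F` at frequency `2^k` is a convolution of `D^α F` and has variation
`O(2^{k(1/r-α)} ‖D^α F‖_r)`, which is summable. -/
theorem exists_continuous_rVariation_le (r : ℝ≥0∞) [Fact (1 ≤ r)] (α : ℝ≥0)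
    (hα : r⁻¹ < (α : ℝ≥0∞)) :
    ∃ C : ℝ≥0, 0 < C ∧ ∀ F : ℝ → ℂ, HasCompactSupport F → MemLp F r volume →
      ∀ g : Lp ℂ r (volume : Measure ℝ), (g : 𝓢'(ℝ, ℂ)) = fracDeriv α F →
        ∃ G : ℝ → ℂ, Continuous G ∧ G =ᵐ[volume] F ∧
          rVariation r G ≤ C * (eLpNorm F r volume + eLpNorm g r volume) := by
  have hr : 1 ≤ r := Fact.out
  obtain ⟨χ, hc, hle, h1⟩ := exists_schwartz_cutoff
  obtain ⟨ψ, hψ⟩ := exists_schwartz_mul_symbol_eq χ hc h1 α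
  obtain ⟨C₀, hC₀⟩ := exists_rVariation_fourierInv_mul_fracSymbol_le r χ
  obtain ⟨C₁, hC₁⟩ := exists_rVariation_fourierInv_mul_fracSymbol_le r ψ
  set ρ : ℝ := (2 : ℝ) ^ (1 / r.toReal - α) with hρ
  have hρ0 : 0 ≤ ρ := by positivity
  have hexp : 1 / r.toReal < α := by
    have := (ENNReal.toReal_lt_toReal (by simp; positivity) ENNReal.coe_ne_top).2 hα
    simpa [ENNReal.toReal_inv] using this
  have hρ1 : ρ < 1 := Real.rpow_lt_one_of_one_lt_of_neg one_lt_two (by linarith)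
  set S : ℝ≥0∞ := ∑' k : ℕ, ENNReal.ofReal (ρ ^ (k + 1)) with hS
  have hSfin : S ≠ ∞ := by
    have : Summable fun k : ℕ => ρ ^ (k + 1) :=
      (summable_nat_add_iff 1).2 (summable_geometric_of_lt_one hρ0 hρ1)
    exact this.tsum_ofReal_ne_top
  refine ⟨C₀ + C₁ * S.toNNReal + 1, by positivity, fun F hFc hF g hg => ?_⟩
  have hFi : Integrable F := integrable_of_memLp_of_hasCompactSupport hr hF hFc
  set U : ℕ → ℝ → ℂ := fun N => 𝓕⁻ (fun ξ => χ (((2 : ℝ) ^ N)⁻¹ * ξ) * 𝓕 F ξ) with hU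
  have hint : ∀ N : ℕ, Integrable fun ξ => χ (((2 : ℝ) ^ N)⁻¹ * ξ) * 𝓕 F ξ := integrable_cutoff_mul_fourier hc hFi
  set u : ℕ → ℝ → ℂ := fun k => match k with
    | 0 => U 0
    | k + 1 => fun x => U (k + 1) x - U k x with hu
  have hsumu : ∀ N x, ∑ k ∈ Finset.range (N + 1), u k x = U N x := fun N x => by
    rw [Finset.sum_range_succ']
    change ∑ k ∈ Finset.range N, (U (k + 1) x - U k x) + U 0 x = U N x
    rw [Finset.sum_range_sub (fun k => U k x), sub_add_cancel]
  set b : ℕ → ℝ≥0∞ := fun k => match k with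
    | 0 => C₀ * eLpNorm F r
    | k + 1 => C₁ * ENNReal.ofReal (ρ ^ (k + 1)) * eLpNorm g r with hb_def
  have hUcont : ∀ N, Continuous (U N) := fun N => continuous_fourierInv_of_integrable (hint N)
  have hUzero : ∀ N, Filter.Tendsto (U N) (Filter.cocompact ℝ) (nhds 0) := fun N =>
    tendsto_fourierInv_cocompact _
  have hucont : ∀ k, Continuous (u k) := fun k => by
    cases k with
    | zero => exact hUcont 0
    | succ k => exact (hUcont (k + 1)).sub (hUcont k)
  have huzero : ∀ k, Filter.Tendsto (u k) (Filter.cocompact ℝ) (nhds 0) := fun k => by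
    cases k with
    | zero => exact hUzero 0
    | succ k => simpa using (hUzero (k + 1)).sub (hUzero k)
  have hub : ∀ k, rVariation r (u k) ≤ b k := fun k => by
    cases k with
    | zero =>
      -- The low frequencies are those of `D^0 F = F`, so they are controlled by `‖F‖_r`.
      have h := hC₀ 0 F (hF.toLp F) (toLp_eq_fracDeriv hF hFi (fracSymbol_zero F).symm) 1 one_pos
      simp only [fracSymbol_zero, Real.one_rpow, ENNReal.ofReal_one, mul_one,
        eLpNorm_congr_ae hF.coeFn_toLp] at h
      simpa [hu, hU, hb_def] using h
    | succ k =>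
      -- The cut-off at scale `2^(k+1)` costs `2^((k+1)/r)`, and dividing by the symbol of `D^α`
      -- gains `2^(-(k+1)α)`: the product is `ρ^(k+1)`.
      have ha : (0 : ℝ) < 2 ^ (k + 1) := by positivity
      have h := hC₁ α F g hg (2 ^ (k + 1)) ha
      have hpiece : u (k + 1) = fun x => ((((2 : ℝ) ^ (k + 1)) ^ (-(α : ℝ)) : ℝ) : ℂ) *
          𝓕⁻ (fun ξ => ψ (((2 : ℝ) ^ (k + 1))⁻¹ * ξ) * fracSymbol α F ξ) (1 * x) := by
        funext x
        have hconv : ∀ N, Integrable fun ξ =>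
            Real.fourierChar (ξ * x) • (χ (((2 : ℝ) ^ N)⁻¹ * ξ) * 𝓕 F ξ) := fun N => by
          have := (Real.fourierIntegral_convergent_iff (-x)).2 (hint N)
          simpa [mul_comm] using this
        simp only [hu, hU, fourierInv_real_eq, one_mul]
        rw [← integral_sub (hconv _) (hconv _), ← integral_const_mul]
        refine integral_congr_ae (Filter.Eventually.of_forall fun ξ => ?_)
        have h2 : 2 * (((2 : ℝ) ^ (k + 1))⁻¹ * ξ) = ((2 : ℝ) ^ k)⁻¹ * ξ := by
          rw [pow_succ]
          field_simp
        have h3 := hψ (((2 : ℝ) ^ (k + 1))⁻¹ * ξ)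
        have h4 : 2 * Real.pi * |((2 : ℝ) ^ (k + 1))⁻¹ * ξ|
            = ((2 : ℝ) ^ (k + 1))⁻¹ * (2 * Real.pi * |ξ|) := by
          rw [abs_mul, abs_of_pos (inv_pos.2 ha)]
          ring
        rw [h2, h4, Real.mul_rpow (by positivity) (by positivity), Real.inv_rpow ha.le,
          ← Real.rpow_neg ha.le, Complex.ofReal_mul] at h3
        simp only [Circle.smul_def, smul_eq_mul, fracSymbol]
        linear_combination (-(Real.fourierChar (ξ * x) : ℂ) * 𝓕 F ξ) * h3
      rw [hpiece]
      refine (rVariation_const_mul_comp_mul_le hr _ _ one_pos).trans ?_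
      refine (mul_le_mul_right h _).trans_eq ?_
      have hpow : ((2 : ℝ) ^ (k + 1)) ^ (-(α : ℝ)) * ((2 : ℝ) ^ (k + 1)) ^ (1 / r.toReal)
          = ρ ^ (k + 1) := by
        rw [← Real.rpow_add ha, hρ, ← Real.rpow_natCast, ← Real.rpow_natCast, ← Real.rpow_mul two_pos.le,
          ← Real.rpow_mul two_pos.le]
        ring_nf
      simp only [hb_def]
      rw [← hpow, ENNReal.ofReal_mul (by positivity), ← ofReal_norm, Complex.norm_real,
        Real.norm_of_nonneg (by positivity)]
      ring
  have hbsum : ∑' k, b k = C₀ * eLpNorm F r + C₁ * S * eLpNorm g r := by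
    rw [tsum_eq_zero_add' ENNReal.summable]
    simp only [hb_def, hS, ENNReal.tsum_mul_left, ENNReal.tsum_mul_right]
  have hbfin : ∑' k, b k ≠ ∞ := by
    rw [hbsum]
    exact ENNReal.add_ne_top.2 ⟨ENNReal.mul_ne_top ENNReal.coe_ne_top hF.2.ne,
      ENNReal.mul_ne_top (ENNReal.mul_ne_top ENNReal.coe_ne_top hSfin) (Lp.memLp g).2.ne⟩
  obtain ⟨G, hGc, hGV, hGlim, hGbd⟩ :=
    exists_continuous_limit_rVariation_le hr hucont huzero hub hbfin
  simp only [hsumu] at hGlim hGbd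
  refine ⟨G, hGc, ?_, ?_⟩
  · refine ae_eq_of_integral_contDiff_smul_eq hGc.locallyIntegrable hFi.locallyIntegrable
      fun φ hφ hφc => ?_
    have hφc' : HasCompactSupport (Complex.ofRealCLM ∘ φ) := hφc.comp_left rfl
    set Φ : 𝓢(ℝ, ℂ) := hφc'.toSchwartzMap (Complex.ofRealCLM.contDiff.comp hφ)
    have hΦ : ∀ x, Φ x = (φ x : ℂ) := fun x => rfl
    have hlim1 := tendsto_integral_fourierInv_cutoff hc hle h1 hFi Φ
    have hlim2 : Filter.Tendsto (fun N => ∫ x, U N x * Φ x) Filter.atTop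
        (nhds (∫ x, G x * Φ x)) := by
      refine tendsto_integral_of_dominated_convergence
        (fun x => (∑' k, (b k).toReal) * ‖Φ x‖)
        (fun N => ((hUcont N).mul Φ.continuous).aestronglyMeasurable)
        (Φ.integrable.norm.const_mul _) (fun N => Filter.Eventually.of_forall fun x => ?_)
        (Filter.Eventually.of_forall fun x => (hGlim x).mul_const _)
      rw [norm_mul]
      gcongr
      exact hGbd N x
    have := tendsto_nhds_unique hlim2 hlim1
    simpa only [hΦ, Complex.real_smul, mul_comm] using this
  · rw [hbsum] at hGV
    refine hGV.trans ?_
    have hC : ((C₀ + C₁ * S.toNNReal + 1 : ℝ≥0) : ℝ≥0∞) = C₀ + C₁ * S + 1 := by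
      push_cast
      rw [ENNReal.coe_toNNReal hSfin]
    rw [hC, mul_add]
    gcongr
    · exact le_self_add.trans le_self_add
    · exact le_add_self.trans le_self_add

end

/-! ### Translates of functions of finite variation -/

theorem tsum_int_le_of_forall_sum_range_le {a : ℤ → ℝ≥0∞} {B : ℝ≥0∞}
    (h : ∀ (n : ℤ) (J : ℕ), ∑ j ∈ Finset.range J, a (n + j) ≤ B) : ∑' k, a k ≤ B := by
  rw [ENNReal.tsum_eq_iSup_sum]
  refine iSup_le fun S => ?_
  obtain ⟨M, hM⟩ : ∃ M : ℕ, ∀ k ∈ S, k.natAbs ≤ M :=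
    ⟨S.sup Int.natAbs, fun k hk => Finset.le_sup hk⟩
  refine le_trans ?_ (h (-M) (2 * M + 1))
  rw [← Finset.sum_image (f := a) (g := fun j : ℕ => (-M + j : ℤ)) fun i _ j _ hij => by
    simpa using hij]
  refine Finset.sum_le_sum_of_subset fun k hk => ?_
  have := hM k hk
  exact Finset.mem_image.2 ⟨(k + M).toNat, by simp; omega, by omega⟩

section

variable {r : ℝ≥0∞}

theorem lintegral_enorm_sub_translate_le_of_pos (hr : 1 ≤ r) (hr' : r ≠ ∞) {F : ℝ → ℂ}
    (hF : AEStronglyMeasurable F) {h : ℝ} (hh : 0 < h) :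
    ∫⁻ x, ‖F (x + h) - F x‖ₑ ^ r.toReal ≤ ENNReal.ofReal h * rVariation r F ^ r.toReal := by
  have hs0 : 0 < r.toReal := ENNReal.toReal_pos (by positivity) hr'
  set f : ℝ → ℝ≥0∞ := fun x => ‖F (x + h) - F x‖ₑ ^ r.toReal with hf
  have hfm : AEMeasurable f :=
    ((hF.comp_measurePreserving (measurePreserving_add_right volume h)).sub hF).enorm.pow_const _
  have hfk : ∀ k : ℤ, AEMeasurable (fun x => f (x + k • h)) := fun k =>
    hfm.comp_quasiMeasurePreserving
      (measurePreserving_add_right volume (k • h)).quasiMeasurePreserving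
  have hpt : ∀ x, ∑' k : ℤ, f (x + k • h) ≤ rVariation r F ^ r.toReal := fun x => by
    refine tsum_int_le_of_forall_sum_range_le fun n J => ?_
    have hmono : StrictMono fun j : Fin (J + 1) => x + ((n + (j : ℕ) : ℤ) : ℝ) * h := fun i j hij => by
      have : ((i : ℕ) : ℝ) < (j : ℕ) := by exact_mod_cast hij
      push_cast
      gcongr
    have := ENNReal.rpow_le_rpow (sum_rpow_le_rVariation hr' F hmono) hs0.le
    rw [← ENNReal.rpow_mul, one_div_mul_cancel hs0.ne', ENNReal.rpow_one] at this
    refine le_trans (le_of_eq ?_) this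
    rw [← Fin.sum_univ_eq_sum_range (fun j => f (x + (n + (j : ℤ)) • h))]
    refine Finset.sum_congr rfl fun j _ => ?_
    simp only [hf, zsmul_eq_mul, Fin.val_succ, Fin.val_castSucc]
    congr 4
    push_cast
    ring_nf
  calc ∫⁻ x, f x = ∑' k : ℤ, ∫⁻ x in Set.Ioc (k • h) ((k + 1) • h), f x := by
        rw [← lintegral_iUnion (fun _ => measurableSet_Ioc) (Set.pairwise_disjoint_Ioc_zsmul h),
          iUnion_Ioc_zsmul hh, Measure.restrict_univ]
    _ = ∑' k : ℤ, ∫⁻ x in Set.Ioc 0 h, f (x + k • h) := by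
        refine tsum_congr fun k => ?_
        rw [← (measurePreserving_add_right volume (k • h)).setLIntegral_comp_preimage_emb
          (measurableEmbedding_addRight _)]
        congr 2
        simp [add_mul]
    _ = ∫⁻ x in Set.Ioc 0 h, ∑' k : ℤ, f (x + k • h) :=
        (lintegral_tsum fun k => (hfk k).restrict).symm
    _ ≤ ∫⁻ x in Set.Ioc 0 h, rVariation r F ^ r.toReal := lintegral_mono fun x => hpt x
    _ = _ := by simp [mul_comm]

/-- A function of finite `r`-variation has `L^r` modulus of continuity at most `V_r(F) |y|^{1/r}`:
averaging over `x ∈ (0, y]` the sums along the progressions `x + yℤ` recovers the integral. -/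
theorem eLpNorm_sub_translate_le (hr : 1 ≤ r) (hr' : r ≠ ∞) {F : ℝ → ℂ}
    (hF : AEStronglyMeasurable F) (y : ℝ) :
    eLpNorm (fun x => F x - F (x - y)) r
      ≤ rVariation r F * ENNReal.ofReal (|y| ^ (1 / r.toReal)) := by
  have hs0 : 0 < r.toReal := ENNReal.toReal_pos (by positivity) hr'
  have key : ∫⁻ x, ‖F x - F (x - y)‖ₑ ^ r.toReal
      ≤ ENNReal.ofReal |y| * rVariation r F ^ r.toReal := by
    rcases lt_trichotomy y 0 with hy | rfl | hy
    · have := lintegral_enorm_sub_translate_le_of_pos hr hr' hF (neg_pos.2 hy)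
      rw [abs_of_neg hy]
      simp only [← sub_eq_add_neg] at this
      simpa only [enorm_sub_rev (F _) (F (_ - y))] using this
    · simp [hs0]
    · rw [abs_of_pos hy, ← lintegral_add_right_eq_self _ y]
      simpa using lintegral_enorm_sub_translate_le_of_pos hr hr' hF hy
  rw [eLpNorm_eq_lintegral_rpow_enorm_toReal (by positivity) hr']
  refine (ENNReal.rpow_le_rpow key (by positivity)).trans_eq ?_
  rw [ENNReal.mul_rpow_of_nonneg _ _ (by positivity), ← ENNReal.rpow_mul,
    mul_one_div_cancel hs0.ne', ENNReal.rpow_one,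
    ENNReal.ofReal_rpow_of_nonneg (abs_nonneg y) (by positivity), mul_comm]

/-- A form of Minkowski's integral inequality: if the slices `H(·, y)` have `L^r` norm at most
`M a(y)`, then `∫ |H(·, y)| w(y) dy` has `L^r` norm at most `M ∫ a w`. Hölder's inequality is applied
with the weight `a w`. -/
theorem eLpNorm_lintegral_mul_le (hr : 1 ≤ r) (hr' : r ≠ ∞) {H : ℝ × ℝ → ℂ}
    (hH : AEStronglyMeasurable H (volume.prod volume)) {a w : ℝ → ℝ≥0∞} (ha : Measurable a)
    (hw : Measurable w) (ha0 : ∀ᵐ y, a y ≠ 0) (ha' : ∀ y, a y ≠ ∞) {M : ℝ≥0∞}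
    (hM : ∀ y, eLpNorm (fun x => H (x, y)) r ≤ M * a y) :
    eLpNorm (fun x => ∫⁻ y, ‖H (x, y)‖ₑ * w y) r ≤ M * ∫⁻ y, a y * w y := by
  have hs : 1 ≤ r.toReal := one_le_toReal hr hr'
  have hs0 : 0 < r.toReal := by linarith
  set s := r.toReal with hs_def
  set A := ∫⁻ y, a y * w y with hA
  have hHe : AEMeasurable (fun z : ℝ × ℝ => ‖H z‖ₑ) (volume.prod volume) := hH.enorm
  have hjoint : AEMeasurable (fun z : ℝ × ℝ => a z.2 * w z.2 * (‖H z‖ₑ / a z.2) ^ s)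
      (volume.prod volume) :=
    ((ha.comp measurable_snd).mul (hw.comp measurable_snd)).aemeasurable.mul
      ((hHe.div (ha.comp measurable_snd).aemeasurable).pow_const s)
  have hslice : ∀ᵐ x, AEMeasurable (fun y => ‖H (x, y)‖ₑ) := by
    filter_upwards [hH.prodMk_left] with x hx
    exact hx.enorm
  have h1 : ∀ᵐ x, (∫⁻ y, ‖H (x, y)‖ₑ * w y) ^ s
      ≤ A ^ (s - 1) * ∫⁻ y, a y * w y * (‖H (x, y)‖ₑ / a y) ^ s := by
    filter_upwards [hslice] with x hx
    refine le_trans (le_of_eq ?_) (rpow_lintegral_mul_le hs (ha.mul hw).aemeasurable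
      (hx.div ha.aemeasurable))
    congr 1
    refine lintegral_congr_ae ?_
    filter_upwards [ha0] with y hy
    rw [mul_right_comm, ENNReal.mul_div_cancel hy (ha' y)]
  have h2 : ∀ᵐ y, ∫⁻ x, a y * w y * (‖H (x, y)‖ₑ / a y) ^ s ≤ a y * w y * M ^ s := by
    have hsw : AEStronglyMeasurable (fun z : ℝ × ℝ => H z.swap) (volume.prod volume) :=
      hH.prod_swap
    filter_upwards [ha0, hsw.prodMk_left] with y hy hym
    have hpow : ∫⁻ x, ‖H (x, y)‖ₑ ^ s ≤ M ^ s * a y ^ s := by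
      have := ENNReal.rpow_le_rpow (hM y) hs0.le
      rwa [eLpNorm_eq_lintegral_rpow_enorm_toReal (by positivity) hr', ← ENNReal.rpow_mul,
        one_div_mul_cancel hs0.ne', ENNReal.rpow_one, ENNReal.mul_rpow_of_nonneg _ _ hs0.le] at this
    have hHm : AEMeasurable fun x => ‖H (x, y)‖ₑ := hym.enorm
    simp only [ENNReal.div_rpow_of_nonneg _ _ hs0.le]
    rw [lintegral_const_mul'' _ ((hHm.pow_const s).div_const _)]
    gcongr
    simp only [div_eq_mul_inv]
    rw [lintegral_mul_const'' _ (hHm.pow_const s), ← div_eq_mul_inv]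
    exact ENNReal.div_le_of_le_mul hpow
  have h3 : ∫⁻ x, (∫⁻ y, ‖H (x, y)‖ₑ * w y) ^ s ≤ (M * A) ^ s := calc
    _ ≤ ∫⁻ x, A ^ (s - 1) * ∫⁻ y, a y * w y * (‖H (x, y)‖ₑ / a y) ^ s := lintegral_mono_ae h1
    _ = A ^ (s - 1) * ∫⁻ y, ∫⁻ x, a y * w y * (‖H (x, y)‖ₑ / a y) ^ s := by
      rw [lintegral_const_mul'' _ hjoint.lintegral_prod_right', lintegral_lintegral_swap hjoint]
    _ ≤ A ^ (s - 1) * ∫⁻ y, a y * w y * M ^ s := by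
      gcongr 1
      exact lintegral_mono_ae h2
    _ = (M * A) ^ s := by
      rw [lintegral_mul_const _ (by fun_prop : Measurable fun y => a y * w y), ← hA, ENNReal.mul_rpow_of_nonneg _ _ hs0.le,
        ← mul_assoc, mul_comm (M ^ s)]
      congr 1
      nth_rewrite 2 [← ENNReal.rpow_one A]
      rw [← ENNReal.rpow_add_of_nonneg _ _ (by linarith) zero_le_one, sub_add_cancel]
  rw [eLpNorm_eq_lintegral_rpow_enorm_toReal (by positivity) hr']
  simp only [enorm_eq_self]
  refine (ENNReal.rpow_le_rpow h3 (by positivity)).trans_eq ?_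
  rw [← ENNReal.rpow_mul, mul_one_div_cancel hs0.ne', ENNReal.rpow_one]

end

/-! ### The singular integral for the fractional derivative -/

theorem integrable_min_one_rpow_mul_rpow {σ β : ℝ} (hβ : 0 < β) (hσ : β < σ) :
    Integrable fun y : ℝ => min 1 (|y| ^ σ) * |y| ^ (-1 - β) := by
  have hσ0 : 0 < σ := hβ.trans hσ
  have h0 : IntegrableOn (fun y : ℝ => min 1 (|y| ^ σ) * |y| ^ (-1 - β)) (Set.Ioi 0) := by
    rw [← Set.Ioc_union_Ioi_eq_Ioi zero_le_one]
    refine IntegrableOn.union ?_ ?_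
    · have : IntegrableOn (fun y : ℝ => y ^ (σ - 1 - β)) (Set.Ioc 0 1) := by
        rw [← intervalIntegrable_iff_integrableOn_Ioc_of_le zero_le_one]
        exact intervalIntegral.intervalIntegrable_rpow' (by linarith)
      refine this.congr_fun (fun y hy => ?_) measurableSet_Ioc
      simp only
      rw [abs_of_pos hy.1, min_eq_right (Real.rpow_le_one hy.1.le hy.2 hσ0.le),
        ← Real.rpow_add hy.1]
      ring_nf
    · refine (integrableOn_Ioi_rpow_of_lt (by linarith : -1 - β < -1) one_pos).congr_fun
        (fun y hy => ?_) measurableSet_Ioi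
      have hy1 : (1 : ℝ) < y := hy
      simp only
      rw [abs_of_pos (by linarith), min_eq_left (Real.one_le_rpow hy1.le hσ0.le), one_mul]
  have hneg : IntegrableOn (fun y : ℝ => min 1 (|y| ^ σ) * |y| ^ (-1 - β)) (Set.Iic 0) := by
    rw [← Measure.map_neg_eq_self (volume : Measure ℝ)]
    let m : MeasurableEmbedding fun x : ℝ => -x := (Homeomorph.neg ℝ).measurableEmbedding
    rw [m.integrableOn_map_iff]
    simp_rw [Function.comp_def, abs_neg, Set.neg_preimage, Set.neg_Iic, neg_zero]
    exact Iff.mpr integrableOn_Ici_iff_integrableOn_Ioi h0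
  rw [← integrableOn_univ, ← Set.Iic_union_Ioi (a := (0 : ℝ))]
  exact hneg.union h0

/-- The symbol of the singular integral `F ↦ ∫ (F(x) - F(x - y)) |y|^{-1-β} dy`. -/
noncomputable def singularSymbol (β ξ : ℝ) : ℂ :=
  ∫ y : ℝ, (1 - (Real.fourierChar (-(y * ξ)) : ℂ)) * ((|y| ^ (-1 - β) : ℝ) : ℂ)

theorem singularSymbol_eq_rpow_mul {β : ℝ} (hβ : 0 < β) (ξ : ℝ) :
    singularSymbol β ξ = ((|ξ| ^ β : ℝ) : ℂ) * singularSymbol β 1 := by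
  rcases eq_or_ne ξ 0 with rfl | hξ
  · simp [singularSymbol, Real.zero_rpow hβ.ne']
  have hpos : 0 < |ξ| := abs_pos.2 hξ
  have h := Measure.integral_comp_mul_left
    (fun y : ℝ => (1 - (Real.fourierChar (-(y * 1)) : ℂ)) * ((|y| ^ (-1 - β) : ℝ) : ℂ)) ξ
  have hfun : ∀ y : ℝ, (1 - (Real.fourierChar (-(y * ξ)) : ℂ)) * ((|y| ^ (-1 - β) : ℝ) : ℂ)
      = ((|ξ| ^ (1 + β) : ℝ) : ℂ) * ((1 - (Real.fourierChar (-(ξ * y * 1)) : ℂ)) *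
        ((|ξ * y| ^ (-1 - β) : ℝ) : ℂ)) := fun y => by
    have h1 : |ξ| ^ (1 + β) * |ξ * y| ^ (-1 - β) = |y| ^ (-1 - β) := by
      rw [abs_mul, Real.mul_rpow (abs_nonneg _) (abs_nonneg _), ← mul_assoc, ← Real.rpow_add hpos]
      simp
    rw [mul_one, mul_comm ξ y, mul_left_comm, ← Complex.ofReal_mul, mul_comm y ξ, h1]
  have h2 : |ξ| ^ (1 + β) * |ξ⁻¹| = |ξ| ^ β := by
    rw [abs_inv, Real.rpow_add hpos, Real.rpow_one]
    field_simp
  rw [singularSymbol, integral_congr_ae (Filter.Eventually.of_forall hfun), integral_const_mul, h,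
    Complex.real_smul, ← mul_assoc, ← Complex.ofReal_mul, h2]
  rfl

theorem singularSymbol_one_ne_zero {β : ℝ} (hβ : 0 < β) (hβ1 : β < 1) :
    singularSymbol β 1 ≠ 0 := by
  set f : ℝ → ℂ := fun y => (1 - (Real.fourierChar (-(y * 1)) : ℂ)) * ((|y| ^ (-1 - β) : ℝ) : ℂ)
  have hmeas : AEStronglyMeasurable f := by
    refine AEStronglyMeasurable.mul ?_ ?_
    · exact (by fun_prop : Continuous fun y : ℝ =>
        (1 - (Real.fourierChar (-(y * 1)) : ℂ))).aestronglyMeasurable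
    · exact (by fun_prop : Measurable fun y : ℝ =>
        ((|y| ^ (-1 - β) : ℝ) : ℂ)).aestronglyMeasurable
  have hint : Integrable f := by
    refine ((integrable_min_one_rpow_mul_rpow hβ hβ1).const_mul (2 * Real.pi)).mono' hmeas
      (Filter.Eventually.of_forall fun y => ?_)
    have h1 : ‖(1 - (Real.fourierChar (-(y * 1)) : ℂ))‖ ≤ 2 * Real.pi * |y| := by
      rw [norm_sub_rev, Real.fourierChar_apply, mul_comm _ Complex.I]
      refine (Real.norm_exp_I_mul_ofReal_sub_one_le).trans_eq ?_
      rw [Real.norm_eq_abs, mul_one, mul_neg, abs_neg, abs_mul, abs_of_pos Real.two_pi_pos]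
    have h2 : ‖(1 - (Real.fourierChar (-(y * 1)) : ℂ))‖ ≤ 2 * Real.pi := by
      refine (norm_sub_le _ _).trans ?_
      rw [norm_one, Circle.norm_coe]
      linarith [Real.pi_gt_three]
    rw [norm_mul, Complex.norm_real, Real.norm_of_nonneg (by positivity), ← mul_assoc,
      Real.rpow_one]
    gcongr
    rcases le_total |y| 1 with h | h
    · rwa [min_eq_right h]
    · rw [min_eq_left h]
      linarith
  intro h0
  have hre : ∫ y, (f y).re = 0 := by
    have := congrArg Complex.re h0
    rwa [singularSymbol, ← RCLike.re_eq_complex_re, ← integral_re hint] at this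
  have hfre : ∀ y, (f y).re = (1 - Real.cos (2 * Real.pi * y)) * |y| ^ (-1 - β) := fun y => by
    simp only [f]
    rw [Complex.re_mul_ofReal, Complex.sub_re, Complex.one_re, Real.fourierChar_apply,
      Complex.exp_ofReal_mul_I_re, mul_one, mul_neg, Real.cos_neg]
  have hnonneg : 0 ≤ fun y => (f y).re := fun y => by
    simp only [hfre, Pi.zero_apply]
    exact mul_nonneg (sub_nonneg.2 (Real.cos_le_one _)) (by positivity)
  have hpos : 0 < ∫ y, (f y).re := by
    rw [integral_pos_iff_support_of_nonneg hnonneg hint.re]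
    refine lt_of_lt_of_le ?_ (measure_mono (s := Set.Ioo (0 : ℝ) 1) fun y hy => ?_)
    · simp
    · rw [Function.mem_support, hfre]
      refine mul_ne_zero (fun h => ?_) (Real.rpow_pos_of_pos (abs_pos.2 hy.1.ne') _).ne'
      have hpi := Real.pi_pos
      have := (Real.cos_eq_one_iff_of_lt_of_lt (x := 2 * Real.pi * y)
        (by nlinarith [hy.1]) (by nlinarith [hy.2])).1 (by linarith)
      have := hy.1.ne'
      simp_all
  exact hpos.ne' hre

section

variable {F : ℝ → ℂ} {β : ℝ}

/-- The integrand `(F(x) - F(x - y)) |y|^{-1-β}` of the singular integral. -/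
noncomputable def singularIntegrand (β : ℝ) (F : ℝ → ℂ) (z : ℝ × ℝ) : ℂ :=
  (F z.1 - F (z.1 - z.2)) * ((|z.2| ^ (-1 - β) : ℝ) : ℂ)

theorem aestronglyMeasurable_sub_translate (hF : AEStronglyMeasurable F) :
    AEStronglyMeasurable (fun z : ℝ × ℝ => F z.1 - F (z.1 - z.2)) (volume.prod volume) :=
  hF.comp_fst.sub (hF.comp_quasiMeasurePreserving
    (quasiMeasurePreserving_sub_of_right_invariant volume volume))

theorem aestronglyMeasurable_singularIntegrand (hF : AEStronglyMeasurable F) :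
    AEStronglyMeasurable (singularIntegrand β F) (volume.prod volume) :=
  (aestronglyMeasurable_sub_translate hF).mul
    (by fun_prop : Measurable fun z : ℝ × ℝ =>
      ((|z.2| ^ (-1 - β) : ℝ) : ℂ)).aestronglyMeasurable

theorem enorm_singularIntegrand (x y : ℝ) : ‖singularIntegrand β F (x, y)‖ₑ
    = ‖F x - F (x - y)‖ₑ * ENNReal.ofReal (|y| ^ (-1 - β)) := by
  rw [singularIntegrand, enorm_mul, ← ofReal_norm (((|y| ^ (-1 - β) : ℝ) : ℂ)), Complex.norm_real,
    Real.norm_of_nonneg (by positivity)]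

/-- If `‖F - F(· - y)‖_p ≤ M min(1, |y|^σ)` with `σ > β`, the singular integral converges absolutely
and its `L^p` norm is at most a constant times `M`. -/
theorem eLpNorm_lintegral_singularIntegrand_le {p : ℝ≥0∞} (hp : 1 ≤ p) (hp' : p ≠ ∞)
    (hF : AEStronglyMeasurable F) {σ : ℝ} (hβ : 0 < β) (hσ : β < σ) {M : ℝ≥0∞}
    (hM : ∀ y, eLpNorm (fun x => F x - F (x - y)) p
      ≤ M * ENNReal.ofReal (min 1 (|y| ^ σ))) :
    eLpNorm (fun x => ∫⁻ y, ‖singularIntegrand β F (x, y)‖ₑ) p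
      ≤ M * ENNReal.ofReal (∫ y, min 1 (|y| ^ σ) * |y| ^ (-1 - β)) := by
  have h0 : ∀ᵐ y : ℝ, ENNReal.ofReal (min 1 (|y| ^ σ)) ≠ 0 := by
    have : ∀ᵐ y : ℝ, y ≠ 0 := Measure.ae_ne volume 0
    filter_upwards [this] with y hy
    have : 0 < |y| := abs_pos.2 hy
    positivity
  have h := eLpNorm_lintegral_mul_le hp hp' (aestronglyMeasurable_sub_translate hF)
    (a := fun y => ENNReal.ofReal (min 1 (|y| ^ σ)))
    (w := fun y => ENNReal.ofReal (|y| ^ (-1 - β))) (by fun_prop) (by fun_prop) h0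
    (fun y => ENNReal.ofReal_ne_top) hM
  simp only [enorm_singularIntegrand]
  refine h.trans_eq ?_
  rw [ofReal_integral_eq_lintegral_ofReal (integrable_min_one_rpow_mul_rpow hβ hσ)
    (Filter.Eventually.of_forall fun y => by positivity)]
  congr 2
  funext y
  rw [ENNReal.ofReal_mul (by positivity)]

theorem fourier_singularIntegral (hF : Integrable F)
    (hint : Integrable (singularIntegrand β F) (volume.prod volume)) (ξ : ℝ) :
    𝓕 (fun x => ∫ y, singularIntegrand β F (x, y)) ξ = singularSymbol β ξ * 𝓕 F ξ := by
  have hconv : ∀ y, Integrable fun x => Real.fourierChar (-(x * ξ)) • F (x - y) := fun y => by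
    have := (Real.fourierIntegral_convergent_iff ξ).2 (hF.comp_sub_right y)
    simpa [mul_comm] using this
  have htrans : ∀ y, ∫ x, Real.fourierChar (-(x * ξ)) • F (x - y)
      = (Real.fourierChar (-(y * ξ)) : ℂ) * 𝓕 F ξ := fun y => by
    rw [← integral_add_right_eq_self _ y, Real.fourier_real_eq, ← integral_const_mul]
    refine integral_congr_ae (Filter.Eventually.of_forall fun x => ?_)
    simp only [add_sub_cancel_right, add_mul, neg_add, AddChar.map_add_eq_mul, Circle.smul_def,
      Circle.coe_mul, smul_eq_mul]
    ring
  have hbig : Integrable (Function.uncurry fun x y : ℝ =>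
      Real.fourierChar (-(x * ξ)) • singularIntegrand β F (x, y)) (volume.prod volume) := by
    refine hint.mono ?_ (Filter.Eventually.of_forall fun z => ?_)
    · exact (by fun_prop : Continuous fun z : ℝ × ℝ =>
        Real.fourierChar (-(z.1 * ξ))).aestronglyMeasurable.smul hint.1
    · simp [Function.uncurry, Circle.norm_smul]
  rw [Real.fourier_real_eq]
  calc ∫ x, Real.fourierChar (-(x * ξ)) • ∫ y, singularIntegrand β F (x, y)
      = ∫ x, ∫ y, Real.fourierChar (-(x * ξ)) • singularIntegrand β F (x, y) := by
        simp only [Circle.smul_def, integral_smul]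
    _ = ∫ y, ∫ x, Real.fourierChar (-(x * ξ)) • singularIntegrand β F (x, y) :=
        integral_integral_swap hbig
    _ = ∫ y, (1 - (Real.fourierChar (-(y * ξ)) : ℂ)) * ((|y| ^ (-1 - β) : ℝ) : ℂ) * 𝓕 F ξ := by
        refine integral_congr_ae (Filter.Eventually.of_forall fun y => ?_)
        have h0 := htrans 0
        have hc0 := hconv 0
        simp only [sub_zero, zero_mul, neg_zero, AddChar.map_zero_eq_one, Circle.coe_one,
          one_mul] at h0 hc0
        simp only [singularIntegrand, ← smul_mul_assoc, smul_sub]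
        rw [integral_mul_const, integral_sub hc0 (hconv y), h0, htrans y]
        ring
    _ = _ := by rw [integral_mul_const, singularSymbol]

end

section

variable {r : ℝ≥0∞} {F : ℝ → ℂ}

theorem eLpNorm_sub_translate_le_two_mul (hr : 1 ≤ r) (hF : AEStronglyMeasurable F) (y : ℝ) :
    eLpNorm (fun x => F x - F (x - y)) r ≤ 2 * eLpNorm F r := by
  have hmp := measurePreserving_sub_right (volume : Measure ℝ) y
  refine (eLpNorm_sub_le hF (hF.comp_measurePreserving hmp) hr).trans_eq ?_
  rw [eLpNorm_comp_measurePreserving hF hmp, two_mul]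

theorem eLpNorm_sub_translate_le_mul_min (hr : 1 ≤ r) (hr' : r ≠ ∞)
    (hF : AEStronglyMeasurable F) (y : ℝ) :
    eLpNorm (fun x => F x - F (x - y)) r ≤ 2 * (eLpNorm F r + rVariation r F) *
      ENNReal.ofReal (min 1 (|y| ^ (1 / r.toReal))) := by
  rcases le_total 1 (|y| ^ (1 / r.toReal)) with h | h
  · rw [min_eq_left h, ENNReal.ofReal_one, mul_one]
    refine (eLpNorm_sub_translate_le_two_mul hr hF y).trans ?_
    gcongr
    exact le_self_add
  · rw [min_eq_right h]
    refine (eLpNorm_sub_translate_le hr hr' hF y).trans ?_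
    gcongr
    rw [two_mul]
    exact le_add_self.trans le_self_add

/-- The `L¹` modulus of continuity of a compactly supported function is controlled by the `L^r`
one for `|y| ≤ 1`, since the differences are then supported in a fixed ball. -/
theorem exists_eLpNorm_one_sub_translate_le (hr : 1 ≤ r) (hr' : r ≠ ∞)
    (hc : HasCompactSupport F) (hF : MemLp F r) (hV : rVariation r F < ∞) :
    ∃ M : ℝ≥0∞, M ≠ ∞ ∧ ∀ y, eLpNorm (fun x => F x - F (x - y)) 1
      ≤ M * ENNReal.ofReal (min 1 (|y| ^ (1 / r.toReal))) := by
  have hs : 1 ≤ r.toReal := one_le_toReal hr hr'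
  obtain ⟨R, hR⟩ := hc.isCompact.isBounded.subset_closedBall 0
  have hzero : ∀ x, R < |x| → F x = 0 := fun x hx => image_eq_zero_of_notMem_tsupport fun h =>
    absurd (hR h) (by simpa using hx)
  set S := Metric.closedBall (0 : ℝ) (R + 1) with hS
  set D := volume S ^ (1 / (1 : ℝ≥0∞).toReal - 1 / r.toReal) with hD
  have hD' : D ≠ ∞ := ENNReal.rpow_ne_top_of_nonneg
    (by rw [ENNReal.toReal_one, div_one, sub_nonneg, div_le_one (by linarith)]; exact hs)
    measure_closedBall_lt_top.ne
  have hF1 : eLpNorm F 1 ≠ ∞ :=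
    (memLp_one_iff_integrable.2 (integrable_of_memLp_of_hasCompactSupport hr hF hc)).2.ne
  have hfin : rVariation r F * D + 2 * eLpNorm F 1 volume ≠ ∞ := ENNReal.add_ne_top.2
    ⟨ENNReal.mul_ne_top hV.ne hD', ENNReal.mul_ne_top ENNReal.ofNat_ne_top hF1⟩
  refine ⟨rVariation r F * D + 2 * eLpNorm F 1 volume, hfin, fun y => ?_⟩
  rcases le_total 1 |y| with h | h
  · rw [min_eq_left (Real.one_le_rpow h (by positivity)), ENNReal.ofReal_one, mul_one]
    exact (eLpNorm_sub_translate_le_two_mul le_rfl hF.1 y).trans le_add_self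
  · rw [min_eq_right (Real.rpow_le_one (abs_nonneg y) h (by positivity))]
    have hsupp : Function.support (fun x => F x - F (x - y)) ⊆ S := fun x hx => by
      by_contra hxS
      have hxR : R + 1 < |x| := by simpa [hS] using hxS
      have := abs_sub_abs_le_abs_sub x y
      exact hx (by simp only; rw [hzero x (by linarith), hzero (x - y) (by linarith), sub_zero])
    have hm : AEStronglyMeasurable (fun x => F x - F (x - y)) :=
      hF.1.sub (hF.1.comp_measurePreserving (measurePreserving_sub_right volume y))
    rw [← eLpNorm_restrict_eq_of_support_subset hsupp]
    calc _ ≤ eLpNorm (fun x => F x - F (x - y)) r (volume.restrict S) * D := by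
          simpa [hD] using eLpNorm_le_eLpNorm_mul_rpow_measure_univ hr (hm.restrict (s := S))
      _ ≤ rVariation r F * ENNReal.ofReal (|y| ^ (1 / r.toReal)) * D := by
          gcongr
          exact (eLpNorm_mono_measure _ Measure.restrict_le_self).trans
            (eLpNorm_sub_translate_le hr hr' hF.1 y)
      _ = rVariation r F * D * ENNReal.ofReal (|y| ^ (1 / r.toReal)) := by ring
      _ ≤ _ := by
          gcongr
          exact le_self_add

end

/-- Below the critical exponent `1/r`, the `r`-variation controls `D^β`, which is represented for
`β > 0` by an absolutely convergent singular integral. -/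
theorem exists_toLp_eq_fracDeriv_eLpNorm_le (r : ℝ≥0∞) [Fact (1 ≤ r)] (β : ℝ≥0)
    (hβ : (β : ℝ≥0∞) < r⁻¹) :
    ∃ C : ℝ≥0, 0 < C ∧ ∀ F : ℝ → ℂ, HasCompactSupport F → MemLp F r volume →
      rVariation r F < ∞ →
        ∃ g : Lp ℂ r (volume : Measure ℝ), (g : 𝓢'(ℝ, ℂ)) = fracDeriv β F ∧
          eLpNorm g r volume ≤ C * (eLpNorm F r volume + rVariation r F) := by
  have hr : 1 ≤ r := Fact.out
  have hr' : r ≠ ∞ := by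
    rintro rfl
    simp at hβ
  rcases eq_or_ne β 0 with rfl | hβ0
  · refine ⟨1, one_pos, fun F hc hF _ => ⟨hF.toLp F, toLp_eq_fracDeriv hF
      (integrable_of_memLp_of_hasCompactSupport hr hF hc) (fracSymbol_zero F).symm, ?_⟩⟩
    rw [eLpNorm_congr_ae hF.coeFn_toLp, ENNReal.coe_one, one_mul]
    exact le_self_add
  have hβpos : (0 : ℝ) < β := by positivity
  have hβσ : (β : ℝ) < 1 / r.toReal := by
    have := (ENNReal.toReal_lt_toReal ENNReal.coe_ne_top (by simp; positivity)).2 hβ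
    simpa [ENNReal.toReal_inv] using this
  have hs : 1 ≤ r.toReal := one_le_toReal hr hr'
  have hβ1 : (β : ℝ) < 1 := hβσ.trans_le (by rw [div_le_one (by linarith)]; exact hs)
  have hq := singularSymbol_one_ne_zero hβpos hβ1
  -- The singular integral has symbol `|ξ|^β` times the constant `singularSymbol β 1`.
  set c : ℂ := (((2 * Real.pi) ^ (β : ℝ) : ℝ) : ℂ) / singularSymbol β 1 with hc_def
  set W := ∫ y : ℝ, min 1 (|y| ^ (1 / r.toReal)) * |y| ^ (-1 - (β : ℝ)) with hW
  refine ⟨‖c‖₊ * 2 * W.toNNReal + 1, by positivity, fun F hc hF hV => ?_⟩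
  have hFi : Integrable F := integrable_of_memLp_of_hasCompactSupport hr hF hc
  have hmeas : AEStronglyMeasurable (singularIntegrand β F) (volume.prod volume) :=
    aestronglyMeasurable_singularIntegrand hF.1
  -- Absolute convergence on `ℝ × ℝ` is the `L¹` case of Minkowski's inequality.
  have hint : Integrable (singularIntegrand β F) (volume.prod volume) := by
    obtain ⟨M, hMfin, hM⟩ := exists_eLpNorm_one_sub_translate_le hr hr' hc hF hV
    have h := eLpNorm_lintegral_singularIntegrand_le (β := β) le_rfl ENNReal.one_ne_top hF.1
      hβpos hβσ hM
    rw [eLpNorm_one_eq_lintegral_enorm] at h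
    simp only [enorm_eq_self] at h
    refine ⟨hmeas, ?_⟩
    rw [HasFiniteIntegral, lintegral_prod _ hmeas.enorm]
    exact h.trans_lt (ENNReal.mul_lt_top hMfin.lt_top ENNReal.ofReal_lt_top)
  set g : ℝ → ℂ := fun x => c * ∫ y, singularIntegrand β F (x, y) with hg_def
  have hgi : Integrable g := hint.integral_prod_left.const_mul c
  have hgr : eLpNorm g r ≤ ‖c‖ₑ * (2 * (eLpNorm F r volume + rVariation r F) * ENNReal.ofReal W) := by
    have h := eLpNorm_lintegral_singularIntegrand_le (β := β) hr hr' hF.1 hβpos hβσ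
      (eLpNorm_sub_translate_le_mul_min hr hr' hF.1)
    refine (eLpNorm_const_smul_le (c := c)
      (f := fun x => ∫ y, singularIntegrand β F (x, y))).trans ?_
    gcongr
    refine le_trans (eLpNorm_mono_enorm fun x => ?_) h
    rw [enorm_eq_self]
    exact enorm_integral_le_lintegral_enorm _
  have hgL : MemLp g r := by
    have hFV : eLpNorm F r volume + rVariation r F < ∞ := ENNReal.add_lt_top.2 ⟨hF.2, hV⟩
    have h2 : 2 * (eLpNorm F r volume + rVariation r F) < ∞ :=
      ENNReal.mul_lt_top ENNReal.ofNat_lt_top hFV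
    exact ⟨hgi.1, hgr.trans_lt
      (ENNReal.mul_lt_top enorm_lt_top (ENNReal.mul_lt_top h2 ENNReal.ofReal_lt_top))⟩
  have hfour : 𝓕 g = fracSymbol β F := by
    funext ξ
    have h1 : 𝓕 g ξ = c * 𝓕 (fun x => ∫ y, singularIntegrand β F (x, y)) ξ := by
      rw [Real.fourier_real_eq, Real.fourier_real_eq, ← integral_const_mul]
      refine integral_congr_ae (Filter.Eventually.of_forall fun x => ?_)
      simp only [hg_def, Circle.smul_def, smul_eq_mul]
      ring
    rw [h1, fourier_singularIntegral hFi hint, singularSymbol_eq_rpow_mul hβpos, fracSymbol,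
      Real.mul_rpow (by positivity) (abs_nonneg ξ), hc_def, Complex.ofReal_mul]
    field_simp
  refine ⟨hgL.toLp g, toLp_eq_fracDeriv hgL hgi hfour, ?_⟩
  rw [eLpNorm_congr_ae hgL.coeFn_toLp]
  refine hgr.trans ?_
  calc ‖c‖ₑ * (2 * (eLpNorm F r volume + rVariation r F) * ENNReal.ofReal W)
      = (‖c‖ₑ * 2 * ENNReal.ofReal W) * (eLpNorm F r volume + rVariation r F) := by ring
    _ ≤ _ := by
      gcongr
      push_cast
      exact le_self_add

theorem mainTheorem9 (r : ℝ≥0∞) [Fact (1 ≤ r)] :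
    (∀ α : ℝ≥0, α ≤ 1 → r⁻¹ < (α : ℝ≥0∞) →
      ∃ C : ℝ≥0, 0 < C ∧ ∀ F : ℝ → ℂ, HasCompactSupport F → MemLp F r volume →
        ∀ g : Lp ℂ r (volume : Measure ℝ), (g : 𝓢'(ℝ, ℂ)) = fracDeriv α F →
          ∃ G : ℝ → ℂ, Continuous G ∧ G =ᵐ[volume] F ∧
            rVariation r G ≤ C * (eLpNorm F r volume + eLpNorm g r volume)) ∧
    (∀ β : ℝ≥0, (β : ℝ≥0∞) < r⁻¹ →
      ∃ C : ℝ≥0, 0 < C ∧ ∀ F : ℝ → ℂ, HasCompactSupport F → MemLp F r volume →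
        rVariation r F < ∞ →
          ∃ g : Lp ℂ r (volume : Measure ℝ), (g : 𝓢'(ℝ, ℂ)) = fracDeriv β F ∧
            eLpNorm g r volume ≤ C * (eLpNorm F r volume + rVariation r F)) :=
  ⟨fun α _ hα => exists_continuous_rVariation_le r α hα,
    fun β hβ => exists_toLp_eq_fracDeriv_eLpNorm_le r β hβ⟩
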